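/- Fix a finite relational vocabulary (a finite set of relation symbols $R_1,\ldots,R_\rho$, where $R_i$ has arity $r_i$) in which at least one symbol has arity at least $2$. For each positive integer $n$ let $\mathbf{S}_n$ be the set of all structures $\mathcal{M}$ for this vocabulary with universe $[n]=\{1,\ldots,n\}$, that is, all tuples $\mathcal{M}=([n],R_1^{\mathcal M},\ldots,R_\rho^{\mathcal M})$ with $R_i^{\mathcal M}\subseteq [n]^{r_i}$, and let $\mathrm{Aut}(\mathcal{M})$ be the automorphism group of $\mathcal{M}$. For groups $G$ and $K$, write $G\cong K$ if they are isomorphic as abstract groups, and $G\leq K$ if $G$ is isomorphic to a subgroup of $K$. Theorem. For any two finite groups $G$ and $H$, each of the following limits exists in $\mathbb{Q}\cup\{\infty\}$ (in particular, the denominators are nonzero for all sufficiently large $n$): $$\lim_{n\to\infty}\frac{\big|\{\mathcal{M}\in\mathbf{S}_n : H\leq \mathrm{Aut}(\mathcal{M})\}\big|}{\big|\{\mathcal{M}\in\mathbf{S}_n : G\leq \mathrm{Aut}(\mathcal{M})\}\big|},\qquad \lim_{n\to\infty}\frac{\big|\{\mathcal{M}\in\mathbf{S}_n : H\cong \mathrm{Aut}(\mathcal{M})\}\big|}{\big|\{\mathcal{M}\in\mathbf{S}_n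 : G\cong \mathrm{Aut}(\mathcal{M})\}\big|},$$ $$\lim_{n\to\infty}\frac{\big|\{\mathcal{M}\in\mathbf{S}_n : G\cong \mathrm{Aut}(\mathcal{M})\}\big|}{\big|\{\mathcal{M}\in\mathbf{S}_n : G\leq \mathrm{Aut}(\mathcal{M})\}\big|}.$$ -/

import Mathlib

open Filter Topology

namespace FirstOrder.Language

/-- The automorphism group of a first-order structure `S` on `M`, as a group of permutations
of `M`: the permutations underlying the isomorphisms from the structure to itself. -/
def autGroup {L : Language} {M : Type*} (S : L.Structure M) : Subgroup (Equiv.Perm M) where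
  carrier := {g | ∃ φ : M ≃[L] M, φ.toEquiv = g}
  one_mem' := ⟨Equiv.refl L M, rfl⟩
  mul_mem' := by
    rintro _ _ ⟨φ, rfl⟩ ⟨ψ, rfl⟩
    exact ⟨φ.comp ψ, rfl⟩
  inv_mem' := by
    rintro _ ⟨φ, rfl⟩
    exact ⟨φ.symm, rfl⟩

/-- The number of structures `S` with universe `Fin n` such that `G` is isomorphic to a subgroup
of the automorphism group of `S`. -/
noncomputable def countLeAut (L : Language) (G : Type*) [Group G] (n : ℕ) : ℕ :=
  Set.ncard {S : L.Structure (Fin n) | ∃ K : Subgroup (autGroup S), Nonempty (G ≃* K)}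

/-- The number of structures `S` with universe `Fin n` such that `G` is isomorphic to
the automorphism group of `S`. -/
noncomputable def countIsoAut (L : Language) (G : Type*) [Group G] (n : ℕ) : ℕ :=
  Set.ncard {S : L.Structure (Fin n) | Nonempty (G ≃* autGroup S)}

end FirstOrder.Language

/-- The limit of `a n / b n` exists in `ℚ ∪ {∞}`: the quotient is defined for all sufficiently
large `n`, and it converges to a rational number or tends to infinity. -/
def HasLimitInRatOrInfty (a b : ℕ → ℕ) : Prop :=
  (∀ᶠ n in atTop, b n ≠ 0) ∧
    ((∃ q : ℚ, Tendsto (fun n => (a n : ℝ) / (b n : ℝ)) atTop (𝓝 (q : ℝ))) ∨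
      Tendsto (fun n => (a n : ℝ) / (b n : ℝ)) atTop atTop)

/-!
The proof determines the order of growth of the numbers of structures to be compared. Call a
sequence of positive growth (`HasGrowth`) if it is asymptotic to `q * n ^ k * 2 ^ e n`, where `q` is
a positive rational number and `e` is eventually an integer-valued polynomial. Such sequences are
closed under addition, and the quotient of two of them converges to a rational number or tends to
infinity: an integer-valued polynomial either is an integer constant or tends to `±∞` at least
linearly, so that powers of `2` dominate powers of `n` (`HasGrowth.hasLimitInRatOrInfty`). It
remains to show that for a property `P` of groups that is invariant under isomorphism and holds for
the groups isomorphic to a given finite group `G`, the number of structures whose automorphism group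
has the property `P` has positive growth (`RelTuple.hasGrowth_propCount_of_mulEquiv`).

A structure on `V` is a set of tuples, and it is invariant under a group `F` of permutations if it
is a union of orbits of `F` on tuples, so there are `2 ^ o` such structures, where `o` is the number
of these orbits. Let `ρ` be the maximal arity. If `F` moves `y` points, then `o` is smaller than the
number of tuples by at least `y * n ^ (ρ - 1) / 2`; since there are few groups with a small number
of generators moving `y` points, structures whose automorphisms move more than `m` points are rare
(`RelTuple.exists_ncard_lt_moved_aut_mul_le`). Hence only structures count whose automorphisms move
exactly the points of a set `X` of bounded size `s`. There are `n.choose s` such sets, and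
finitely many permutation groups `K` on a set of size `s`.

For a permutation group `K` on a finite set `A`, write `V = A ⊕ Fin t`. The number of structures
invariant under `K` is `2 ^ p t`, with `p` a polynomial by Burnside's formula. Among them, those
with no further automorphisms on `A` have a proportion that converges to a rational number; this follows
by induction on `K` from above, as the proportions of structures invariant under larger groups do so
(`RelTuple.tendsto_restrCount_div`). If the limit is zero, then there are no such structures at
all, for any `t`: from a single one, a positive proportion is obtained by prescribing the structure
on `A ⊕ Fin t₀` (`RelTuple.invCount_le_mul_restrCount`). Finally, almost none of these structures
has an automorphism moving a point outside `A`, because such a permutation, of bounded support,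
joins about `n` pairs of orbits of `K` (`RelTuple.tendsto_autCount_div`).

The sum of the resulting sequences over all `s ≤ m` and all `K` with the property `P` has positive
growth, and the remaining structures are negligible for suitable `m`, because a Cayley graph
provides one group `K ≅ G` that is the full automorphism group of many structures.
-/

/-! ### Sequences of growth `q * n ^ k * 2 ^ e n` -/

/-- The integer sequence `e` eventually agrees with a real polynomial. -/
def EventuallyPolynomial (e : ℕ → ℤ) : Prop :=
  ∃ p : Polynomial ℝ, ∀ᶠ n : ℕ in atTop, (e n : ℝ) = p.eval (n : ℝ)

theorem EventuallyPolynomial.sub {e f : ℕ → ℤ} (he : EventuallyPolynomial e)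
    (hf : EventuallyPolynomial f) : EventuallyPolynomial (fun n => e n - f n) := by
  obtain ⟨p, hp⟩ := he
  obtain ⟨q, hq⟩ := hf
  refine ⟨p - q, ?_⟩
  filter_upwards [hp, hq] with n h1 h2
  simp [h1, h2]

theorem EventuallyPolynomial.comp_sub {e : ℕ → ℤ} (he : EventuallyPolynomial e) (s : ℕ) :
    EventuallyPolynomial (fun n => e (n - s)) := by
  obtain ⟨p, hp⟩ := he
  refine ⟨p.comp (Polynomial.X - Polynomial.C (s : ℝ)), ?_⟩
  filter_upwards [(tendsto_sub_atTop_nat s).eventually hp, eventually_ge_atTop s] with n h1 h2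
  simp [h1, Nat.cast_sub h2]

theorem Polynomial.eventually_linear_le_eval {p : Polynomial ℝ} (hd : 0 < p.degree)
    (hl : 0 ≤ p.leadingCoeff) : ∃ c : ℝ, 0 < c ∧ ∀ᶠ n : ℕ in atTop, c * n ≤ p.eval (n : ℝ) := by
  have hdeg : (Polynomial.X : Polynomial ℝ).degree ≤ p.degree := by
    rw [Polynomial.degree_X, Polynomial.degree_eq_natDegree (by rintro rfl; simp at hd)]
    exact_mod_cast Polynomial.natDegree_pos_iff_degree_pos.2 hd
  obtain ⟨C, hC, h⟩ := (Polynomial.isBigO_atTop_of_degree_le _ _ hdeg).exists_pos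
  have h1 := tendsto_natCast_atTop_atTop (R := ℝ) |>.eventually h.bound
  have h2 := ((Polynomial.tendsto_atTop_of_leadingCoeff_nonneg p hd hl).comp
    (tendsto_natCast_atTop_atTop (R := ℝ))).eventually_ge_atTop 0
  refine ⟨C⁻¹, inv_pos.2 hC, ?_⟩
  filter_upwards [h1, h2] with n h1 h2
  simp only [Function.comp] at h2
  simp only [Polynomial.eval_X, Real.norm_eq_abs, abs_of_nonneg h2, Nat.abs_cast] at h1
  rw [inv_mul_le_iff₀ hC]
  exact h1

/-- A polynomial integer sequence is eventually constant, or tends to `∞` or to `-∞` at least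
linearly. -/
theorem EventuallyPolynomial.trichotomy {e : ℕ → ℤ} (he : EventuallyPolynomial e) :
    (∃ c : ℤ, ∀ᶠ n in atTop, e n = c) ∨
    (∃ c : ℝ, 0 < c ∧ ∀ᶠ n : ℕ in atTop, c * n ≤ e n) ∨
    (∃ c : ℝ, 0 < c ∧ ∀ᶠ n : ℕ in atTop, c * n ≤ -(e n : ℝ)) := by
  obtain ⟨p, hp⟩ := he
  by_cases hd : 0 < p.degree
  · right
    rcases le_total 0 p.leadingCoeff with hl | hl
    · left
      obtain ⟨c, hc, h⟩ := Polynomial.eventually_linear_le_eval hd hl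
      refine ⟨c, hc, ?_⟩
      filter_upwards [h, hp] with n h1 h2
      rwa [h2]
    · right
      obtain ⟨c, hc, h⟩ := Polynomial.eventually_linear_le_eval (p := -p)
        (by rwa [Polynomial.degree_neg]) (by simpa using hl)
      refine ⟨c, hc, ?_⟩
      filter_upwards [h, hp] with n h1 h2
      rw [h2]
      simpa using h1
  · left
    have hconst := Polynomial.eq_C_of_degree_le_zero (not_lt.1 hd)
    rw [hconst] at hp
    simp only [Polynomial.eval_C] at hp
    obtain ⟨N, hN⟩ := eventually_atTop.1 hp
    refine ⟨e N, ?_⟩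
    filter_upwards [eventually_ge_atTop N] with n hn
    have := (hN n hn).trans (hN N le_rfl).symm
    exact_mod_cast this

/-- The model sequence `n ^ k * 2 ^ e n`. -/
noncomputable def growth (k : ℕ) (e : ℕ → ℤ) (n : ℕ) : ℝ := (n : ℝ) ^ k * (2 : ℝ) ^ e n

theorem growth_pos (k : ℕ) (e : ℕ → ℤ) : ∀ᶠ n in atTop, 0 < growth k e n := by
  filter_upwards [eventually_gt_atTop 0] with n hn
  unfold growth
  positivity

theorem tendsto_pow_mul_two_rpow_neg (k : ℕ) {c : ℝ} (hc : 0 < c) :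
    Tendsto (fun n : ℕ => (n : ℝ) ^ k * (2 : ℝ) ^ (-(c * n))) atTop (𝓝 0) := by
  have h := tendsto_pow_const_mul_const_pow_of_abs_lt_one k (r := (2 : ℝ) ^ (-c))
    (by
      rw [abs_of_pos (by positivity)]
      exact Real.rpow_lt_one_of_one_lt_of_neg (by norm_num) (by linarith))
  refine h.congr fun n => ?_
  rw [← Real.rpow_natCast (2 ^ (-c)) n, ← Real.rpow_mul (by norm_num)]
  congr 2
  ring

theorem tendsto_pow_mul_two_zpow (k : ℕ) {e : ℕ → ℤ} {c : ℝ} (hc : 0 < c)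
    (h : ∀ᶠ n : ℕ in atTop, c * n ≤ -(e n : ℝ)) :
    Tendsto (fun n : ℕ => (n : ℝ) ^ k * (2 : ℝ) ^ e n) atTop (𝓝 0) := by
  refine squeeze_zero' (Eventually.of_forall fun n => by positivity) ?_
    (tendsto_pow_mul_two_rpow_neg k hc)
  filter_upwards [h] with n hn
  rw [← Real.rpow_intCast]
  gcongr
  · norm_num
  · linarith

theorem growth_div_growth (k l : ℕ) (e f : ℕ → ℤ) (n : ℕ) :
    growth k e n / growth l f n = (n : ℝ) ^ k / (n : ℝ) ^ l * 2 ^ (e n - f n) := by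
  unfold growth
  rw [zpow_sub₀ (by norm_num), mul_div_mul_comm]

theorem tendsto_growth_div_of_linear {k l : ℕ} {e f : ℕ → ℤ} {c : ℝ} (hc : 0 < c)
    (h : ∀ᶠ n : ℕ in atTop, c * n ≤ -((e n - f n : ℤ) : ℝ)) :
    Tendsto (fun n => growth k e n / growth l f n) atTop (𝓝 0) := by
  refine squeeze_zero' (Eventually.of_forall fun n => by unfold growth; positivity) ?_
    (tendsto_pow_mul_two_zpow k (e := fun n => e n - f n) hc h)
  filter_upwards [eventually_ge_atTop 1] with n hn
  rw [growth_div_growth]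
  gcongr
  exact div_le_self (by positivity) (one_le_pow₀ (by exact_mod_cast hn))

theorem tendsto_growth_div_of_lt {k l : ℕ} {e f : ℕ → ℤ} {c : ℤ} (hkl : k < l)
    (h : ∀ᶠ n in atTop, e n - f n = c) :
    Tendsto (fun n => growth k e n / growth l f n) atTop (𝓝 0) := by
  have h1 : Tendsto (fun n : ℕ => (n : ℝ) ^ k / (n : ℝ) ^ l * 2 ^ c) atTop (𝓝 0) := by
    have := ((tendsto_pow_div_pow_atTop_zero (𝕜 := ℝ) hkl).comp
      tendsto_natCast_atTop_atTop).mul_const ((2 : ℝ) ^ c)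
    simpa [Function.comp_def] using this
  refine h1.congr' ?_
  filter_upwards [h] with n hn
  rw [growth_div_growth, hn]

/-- Any two model sequences are comparable, with a rational limit of the quotient if they have
the same order of magnitude: an integer-valued polynomial that is constant is an integer. -/
theorem growth_trichotomy (k l : ℕ) {e f : ℕ → ℤ} (he : EventuallyPolynomial e)
    (hf : EventuallyPolynomial f) :
    (∃ q : ℚ, 0 < q ∧ Tendsto (fun n => growth k e n / growth l f n) atTop (𝓝 (q : ℝ))) ∨
    Tendsto (fun n => growth k e n / growth l f n) atTop (𝓝 0) ∨
    Tendsto (fun n => growth l f n / growth k e n) atTop (𝓝 0) := by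
  rcases (he.sub hf).trichotomy with ⟨c, hc⟩ | ⟨c, hc, h⟩ | ⟨c, hc, h⟩
  · rcases lt_trichotomy k l with hkl | rfl | hkl
    · exact Or.inr (Or.inl (tendsto_growth_div_of_lt hkl hc))
    · refine Or.inl ⟨(2 : ℚ) ^ c, by positivity, ?_⟩
      refine tendsto_const_nhds.congr' ?_
      filter_upwards [hc, eventually_ge_atTop 1] with n hn hn1
      have : (n : ℝ) ≠ 0 := by positivity
      rw [growth_div_growth, hn, div_self (by positivity)]
      push_cast
      ring
    · refine Or.inr (Or.inr (tendsto_growth_div_of_lt (c := -c) hkl ?_))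
      filter_upwards [hc] with n hn
      omega
  · refine Or.inr (Or.inr (tendsto_growth_div_of_linear hc ?_))
    filter_upwards [h] with n hn
    push_cast at hn ⊢
    linarith
  · exact Or.inr (Or.inl (tendsto_growth_div_of_linear hc h))

/-- The sequence `a` is asymptotic to `q * n ^ k * 2 ^ e n` for a positive rational `q`, a natural
number `k` and a polynomial integer sequence `e`. -/
def HasGrowth (a : ℕ → ℝ) : Prop :=
  ∃ (q : ℚ) (k : ℕ) (e : ℕ → ℤ), 0 < q ∧ EventuallyPolynomial e ∧
    Tendsto (fun n => a n / growth k e n) atTop (𝓝 (q : ℝ))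

theorem HasGrowth.eventually_pos {a : ℕ → ℝ} (ha : HasGrowth a) : ∀ᶠ n in atTop, 0 < a n := by
  obtain ⟨q, k, e, hq, he, h⟩ := ha
  have hq' : (0 : ℝ) < q := by exact_mod_cast hq
  filter_upwards [h.eventually_const_lt hq', growth_pos k e] with n h1 h2
  exact (div_pos_iff_of_pos_right h2).1 h1

theorem tendsto_div_of_div_growth {a b g h : ℕ → ℝ} {x y z : ℝ} (hg : ∀ᶠ n in atTop, 0 < g n)
    (hh : ∀ᶠ n in atTop, 0 < h n)
    (ha : Tendsto (fun n => a n / g n) atTop (𝓝 x)) (hb : Tendsto (fun n => b n / h n) atTop (𝓝 y))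
    (hy : y ≠ 0) (hgh : Tendsto (fun n => g n / h n) atTop (𝓝 z)) :
    Tendsto (fun n => a n / b n) atTop (𝓝 (x * z / y)) := by
  refine ((ha.mul hgh).div hb hy).congr' ?_
  filter_upwards [hg, hh] with n h1 h2
  simp only [Pi.div_apply]
  field_simp

/-- Two sequences of this kind are comparable. -/
theorem HasGrowth.comparison {a b : ℕ → ℝ} (ha : HasGrowth a) (hb : HasGrowth b) :
    (∃ q : ℚ, 0 < q ∧ Tendsto (fun n => a n / b n) atTop (𝓝 (q : ℝ))) ∨
    Tendsto (fun n => a n / b n) atTop (𝓝 0) ∨ Tendsto (fun n => b n / a n) atTop (𝓝 0) := by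
  obtain ⟨q, k, e, hq, he, h⟩ := ha
  obtain ⟨q', k', e', hq', he', h'⟩ := hb
  have hqr : (q : ℝ) ≠ 0 := by exact_mod_cast hq.ne'
  have hqr' : (q' : ℝ) ≠ 0 := by exact_mod_cast hq'.ne'
  rcases growth_trichotomy k k' he he' with ⟨z, hz, hlim⟩ | hlim | hlim
  · refine Or.inl ⟨q * z / q', by positivity, ?_⟩
    have := tendsto_div_of_div_growth (growth_pos _ _) (growth_pos _ _) h h' hqr' hlim
    push_cast
    exact this
  · refine Or.inr (Or.inl ?_)
    simpa using tendsto_div_of_div_growth (growth_pos _ _) (growth_pos _ _) h h' hqr' hlim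
  · refine Or.inr (Or.inr ?_)
    simpa using tendsto_div_of_div_growth (growth_pos _ _) (growth_pos _ _) h' h hqr hlim

theorem HasGrowth.of_tendsto_div {a b : ℕ → ℝ} (hb : HasGrowth b) {q : ℚ} (hq : 0 < q)
    (h : Tendsto (fun n => a n / b n) atTop (𝓝 (q : ℝ))) : HasGrowth a := by
  obtain ⟨q', k, e, hq', he, h'⟩ := id hb
  refine ⟨q * q', k, e, by positivity, he, ?_⟩
  push_cast
  refine (h.mul h').congr' ?_
  filter_upwards [hb.eventually_pos] with n hn
  field_simp

theorem HasGrowth.add {a b : ℕ → ℝ} (ha : HasGrowth a) (hb : HasGrowth b) :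
    HasGrowth (fun n => a n + b n) := by
  have key : ∀ {a b : ℕ → ℝ} (q : ℚ), 0 ≤ q → HasGrowth b →
      Tendsto (fun n => a n / b n) atTop (𝓝 (q : ℝ)) → HasGrowth (fun n => a n + b n) := by
    intro a b q hq hb h
    refine hb.of_tendsto_div (q := q + 1) (by positivity) ?_
    push_cast
    refine (h.add_const 1).congr' ?_
    filter_upwards [hb.eventually_pos] with n hn
    field_simp
  rcases ha.comparison hb with ⟨q, hq, h⟩ | h | h
  · exact key q hq.le hb h
  · exact key 0 le_rfl hb (by simpa using h)
  · simpa only [add_comm] using key 0 le_rfl ha (by simpa using h)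

theorem HasGrowth.choose_mul {a : ℕ → ℝ} (ha : HasGrowth a) (s : ℕ) :
    HasGrowth (fun n => (n.choose s : ℝ) * a n) := by
  obtain ⟨q, k, e, hq, he, h⟩ := ha
  have hs : Tendsto (fun n : ℕ => (n.choose s : ℝ) / (n : ℝ) ^ s) atTop
      (𝓝 ((1 / s.factorial : ℚ) : ℝ)) := by
    have h1 := (Asymptotics.isEquivalent_iff_tendsto_one (by
      filter_upwards [eventually_gt_atTop 0] with n hn
      positivity)).1 (isEquivalent_choose s)
    have h2 := h1.mul_const (1 / (s.factorial : ℝ))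
    push_cast
    rw [one_mul] at h2
    refine h2.congr' ?_
    filter_upwards [eventually_gt_atTop 0] with n hn
    simp only [Pi.div_apply]
    field_simp
  refine ⟨1 / s.factorial * q, s + k, e, by positivity, he, ?_⟩
  push_cast at hs ⊢
  refine (hs.mul h).congr fun n => ?_
  unfold growth
  rw [div_mul_div_comm, pow_add]
  ring

theorem HasGrowth.comp_sub {a : ℕ → ℝ} (ha : HasGrowth a) (s : ℕ) :
    HasGrowth (fun n => a (n - s)) := by
  obtain ⟨q, k, e, hq, he, h⟩ := ha
  refine ⟨q, k, fun n => e (n - s), hq, he.comp_sub s, ?_⟩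
  have h1 := h.comp (tendsto_sub_atTop_nat s)
  have h2 : Tendsto (fun n : ℕ => (((n - s : ℕ) : ℝ) / (n : ℝ)) ^ k) atTop (𝓝 (1 ^ k)) := by
    refine Tendsto.pow ?_ k
    have h3 : Tendsto (fun n : ℕ => 1 - (s : ℝ) / (n : ℝ)) atTop (𝓝 (1 - 0)) :=
      tendsto_const_nhds.sub (tendsto_const_div_atTop_nhds_zero_nat (s : ℝ))
    rw [sub_zero] at h3
    refine h3.congr' ?_
    filter_upwards [eventually_ge_atTop s, eventually_gt_atTop 0] with n hn hn0
    rw [Nat.cast_sub hn]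
    field_simp
  have h4 := h1.mul h2
  rw [one_pow, mul_one] at h4
  refine h4.congr' ?_
  filter_upwards [eventually_gt_atTop s] with n hn
  have h5 : ((n - s : ℕ) : ℝ) ≠ 0 := by
    have : 0 < n - s := by omega
    positivity
  have h6 : (n : ℝ) ≠ 0 := by
    have : 0 < n := by omega
    positivity
  simp only [Function.comp, growth]
  rw [div_pow]
  field_simp

/-- A finite sum of sequences each of which is of this kind or eventually zero is again of this
kind or eventually zero. -/
theorem HasGrowth.sum {J : Type*} (t : Finset J) (a : J → ℕ → ℝ)
    (h : ∀ j ∈ t, HasGrowth (a j) ∨ ∀ᶠ n in atTop, a j n = 0) :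
    HasGrowth (fun n => ∑ j ∈ t, a j n) ∨ ∀ᶠ n in atTop, ∑ j ∈ t, a j n = 0 := by
  classical
  induction t using Finset.induction_on with
  | empty => simp
  | insert j t hj ih =>
    simp only [Finset.sum_insert hj]
    have h1 := h j (Finset.mem_insert_self j t)
    have h2 := ih fun i hi => h i (Finset.mem_insert_of_mem hi)
    have congr0 : ∀ {u v : ℕ → ℝ}, HasGrowth u → (∀ᶠ n in atTop, v n = u n) → HasGrowth v := by
      intro u v hu huv
      refine hu.of_tendsto_div (q := 1) one_pos ?_
      push_cast
      refine tendsto_const_nhds.congr' ?_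
      filter_upwards [huv, hu.eventually_pos] with n hn hn'
      rw [hn, div_self hn'.ne']
    rcases h1 with h1 | h1 <;> rcases h2 with h2 | h2
    · exact Or.inl (h1.add h2)
    · refine Or.inl (congr0 h1 ?_)
      filter_upwards [h2] with n hn
      rw [hn, add_zero]
    · refine Or.inl (congr0 h2 ?_)
      filter_upwards [h1] with n hn
      rw [hn, zero_add]
    · right
      filter_upwards [h1, h2] with n hn1 hn2
      rw [hn1, hn2, add_zero]

theorem HasGrowth.hasLimitInRatOrInfty {a b : ℕ → ℕ} (ha : HasGrowth fun n => (a n : ℝ))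
    (hb : HasGrowth fun n => (b n : ℝ)) : HasLimitInRatOrInfty a b := by
  refine ⟨?_, ?_⟩
  · filter_upwards [hb.eventually_pos] with n hn
    exact_mod_cast hn.ne'
  · rcases ha.comparison hb with ⟨q, -, h⟩ | h | h
    · exact Or.inl ⟨q, h⟩
    · exact Or.inl ⟨0, by simpa using h⟩
    · right
      have h1 : Tendsto (fun n => (b n : ℝ) / (a n : ℝ)) atTop (𝓝[>] 0) := by
        refine tendsto_nhdsWithin_iff.2 ⟨h, ?_⟩
        filter_upwards [ha.eventually_pos, hb.eventually_pos] with n h1 h2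
        exact div_pos h2 h1
      simpa [Pi.inv_def] using h1.inv_tendsto_nhdsGT_zero

/-! ### Counting orbits and invariant sets -/

theorem Set.ncard_eq_sum_ncard_fiber {α β : Type*} [Finite α] (s : Set α) (f : α → β)
    (t : Finset β) (h : ∀ x ∈ s, f x ∈ t) :
    s.ncard = ∑ b ∈ t, {x | x ∈ s ∧ f x = b}.ncard := by
  classical
  have := Fintype.ofFinite α
  rw [Set.ncard_eq_toFinset_card', Finset.card_eq_sum_card_fiberwise (f := f) (t := t)
    (fun x hx => h x (by simpa using hx))]
  refine Finset.sum_congr rfl fun b _ => ?_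
  rw [Set.ncard_eq_toFinset_card']
  congr 1
  ext x
  simp

theorem Set.ncard_le_sum_of_forall_exists {α β : Type*} [Finite α] (s : Set α) (t : Finset β)
    (u : β → Set α) (h : ∀ x ∈ s, ∃ b ∈ t, x ∈ u b) : s.ncard ≤ ∑ b ∈ t, (u b).ncard := by
  classical
  have := Fintype.ofFinite α
  have hs : s.toFinset ⊆ t.biUnion fun b => (u b).toFinset := by
    intro x hx
    obtain ⟨b, hb, hxb⟩ := h x (by simpa using hx)
    exact Finset.mem_biUnion.2 ⟨b, hb, by simpa using hxb⟩
  rw [Set.ncard_eq_toFinset_card']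
  refine (Finset.card_le_card hs).trans (Finset.card_biUnion_le.trans_eq ?_)
  exact Finset.sum_congr rfl fun b _ => (Set.ncard_eq_toFinset_card' _).symm

namespace MulAction

/-- Invariant sets are unions of orbits. -/
theorem ncard_invariant (F T : Type*) [Group F] [MulAction F T] [Finite T] :
    {D : Set T | ∀ (g : F) (t : T), g • t ∈ D ↔ t ∈ D}.ncard =
      2 ^ Nat.card (orbitRel.Quotient F T) := by
  classical
  set mk : T → orbitRel.Quotient F T := Quotient.mk'' with hmk
  have hsurj : Function.Surjective mk := Quotient.mk''_surjective
  have : Finite (orbitRel.Quotient F T) := Finite.of_surjective mk hsurj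
  have := Fintype.ofFinite (orbitRel.Quotient F T)
  have heq : {D : Set T | ∀ (g : F) (t : T), g • t ∈ D ↔ t ∈ D} =
      (fun E : Set (orbitRel.Quotient F T) => mk ⁻¹' E) '' Set.univ := by
    ext D
    constructor
    · intro hD
      refine ⟨mk '' D, trivial, ?_⟩
      ext t
      constructor
      · rintro ⟨t', ht', h⟩
        obtain ⟨g, rfl⟩ := Quotient.exact h
        exact (hD g t).1 ht'
      · exact fun ht => ⟨t, ht, rfl⟩
    · rintro ⟨E, -, rfl⟩ g t
      have : mk (g • t) = mk t := Quotient.sound ⟨g, rfl⟩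
      simp only [Set.mem_preimage, this]
  rw [heq, Set.ncard_image_of_injective _ hsurj.preimage_injective, Set.ncard_univ,
    Nat.card_eq_fintype_card, Fintype.card_set, Nat.card_eq_fintype_card]

/-- Every orbit meeting the set `U` of moved points has at least two elements. -/
theorem two_mul_card_orbits_add_le (F : Type*) {T : Type*} [Group F] [MulAction F T] [Finite T]
    (U : Set T) (hU : ∀ t ∈ U, ∃ g : F, g • t ≠ t) :
    2 * Nat.card (orbitRel.Quotient F T) + U.ncard ≤ 2 * Nat.card T := by
  classical
  set mk : T → orbitRel.Quotient F T := Quotient.mk'' with hmk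
  have hsurj : Function.Surjective mk := Quotient.mk''_surjective
  have : Finite (orbitRel.Quotient F T) := Finite.of_surjective mk hsurj
  have := Fintype.ofFinite (orbitRel.Quotient F T)
  rw [← Set.ncard_univ T, Set.ncard_eq_sum_ncard_fiber Set.univ mk Finset.univ (by simp),
    Set.ncard_eq_sum_ncard_fiber U mk Finset.univ (by simp), Nat.card_eq_fintype_card,
    ← Finset.card_univ, Finset.card_eq_sum_ones, Finset.mul_sum, Finset.mul_sum,
    ← Finset.sum_add_distrib]
  refine Finset.sum_le_sum fun ω _ => ?_
  have hle : {x | x ∈ U ∧ mk x = ω}.ncard ≤ {x | x ∈ Set.univ ∧ mk x = ω}.ncard :=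
    Set.ncard_le_ncard fun x hx => ⟨trivial, hx.2⟩
  rcases Set.eq_empty_or_nonempty {x | x ∈ U ∧ mk x = ω} with h | ⟨t, htU, ht⟩
  · obtain ⟨t, ht⟩ := hsurj ω
    have : 0 < {x | x ∈ Set.univ ∧ mk x = ω}.ncard := (Set.ncard_pos).2 ⟨t, trivial, ht⟩
    rw [h, Set.ncard_empty]
    omega
  · obtain ⟨g, hg⟩ := hU t htU
    have : 1 < {x | x ∈ Set.univ ∧ mk x = ω}.ncard := by
      refine (Set.one_lt_ncard).2 ⟨g • t, ⟨trivial, ?_⟩, t, ⟨trivial, ht⟩, hg⟩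
      rw [← ht]
      exact Quotient.sound ⟨g, rfl⟩
    omega

/-- If a larger group joins each of the distinct orbits of the points `a z` to an orbit outside
this family, then it has at least as many orbits fewer. -/
theorem card_orbits_add_card_le {F T Z : Type*} [Group F] [MulAction F T] [Finite T]
    {K K' : Subgroup F} (hK : K ≤ K') (a b : Z → T)
    (ha : ∀ z z', (∃ g ∈ K, g • a z = a z') → z = z')
    (hab : ∀ z z', ∀ g ∈ K, g • b z ≠ a z')
    (hK' : ∀ z, ∃ g ∈ K', g • a z = b z) :
    Nat.card (orbitRel.Quotient K' T) + Nat.card Z ≤ Nat.card (orbitRel.Quotient K T) := by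
  classical
  let mk : T → orbitRel.Quotient K T := Quotient.mk''
  let mk' : T → orbitRel.Quotient K' T := Quotient.mk''
  have hfin : Finite (orbitRel.Quotient K T) := Finite.of_surjective mk Quotient.mk''_surjective
  have hinj : Function.Injective fun z => mk (a z) := by
    intro z z' h
    obtain ⟨g, hg⟩ := Quotient.exact h
    exact (ha z' z ⟨g, g.2, hg⟩).symm
  have hfinZ : Finite Z := Finite.of_injective _ hinj
  -- the orbits of `K` other than those of the points `a z` still cover all orbits of `K'`
  let R : Set (orbitRel.Quotient K T) := (Set.range fun z => mk (a z))ᶜ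
  let f : R → orbitRel.Quotient K' T := fun x => mk' x.1.out
  have hout : ∀ t : T, mk' (mk t).out = mk' t := by
    intro t
    obtain ⟨g, hg⟩ := (Quotient.mk_out (s := orbitRel K T) t)
    refine Quotient.sound ⟨⟨g, hK g.2⟩, hg⟩
  have hf : Function.Surjective f := by
    intro y
    obtain ⟨t, rfl⟩ := Quotient.mk''_surjective y
    by_cases ht : ∃ z, mk (a z) = mk t
    · obtain ⟨z, hz⟩ := ht
      refine ⟨⟨mk (b z), ?_⟩, ?_⟩
      · rintro ⟨z', hz'⟩
        obtain ⟨g, hg⟩ := Quotient.exact hz'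
        exact hab z z' g g.2 hg
      · have h1 : mk' (b z) = mk' (a z) := by
          obtain ⟨g, hg, h⟩ := hK' z
          exact Quotient.sound ⟨⟨g, hg⟩, h⟩
        have h2 : mk' (a z) = mk' t := by rw [← hout, hz, hout]
        change mk' (mk (b z)).out = mk' t
        rw [hout, h1, h2]
    · exact ⟨⟨mk t, fun ⟨z, hz⟩ => ht ⟨z, hz⟩⟩, hout t⟩
  have h1 := Nat.card_le_card_of_surjective f hf
  have h2 := Set.ncard_add_ncard_compl (Set.range fun z => mk (a z))
  have h3 : (Set.range fun z => mk (a z)).ncard = Nat.card Z := by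
    rw [← Set.image_univ, Set.ncard_image_of_injective _ hinj, Set.ncard_univ]
  have h4 : Nat.card R = (Set.range fun z => mk (a z))ᶜ.ncard := Nat.card_coe_set_eq _
  omega

end MulAction

/-! ### Relational structures as sets of tuples -/

/-- The tuples over `V` that may belong to a relation: an index `i` of a relation symbol and a
tuple whose length is the arity `r i`. A relational structure on `V` is a set of these. -/
abbrev RelTuple {ι : Type*} (r : ι → ℕ) (V : Type*) := Σ i, (Fin (r i) → V)

namespace RelTuple

open Equiv (Perm)

variable {ι : Type*} {r : ι → ℕ} {V W : Type*}

/-- The automorphism group of the relational structure `D`. -/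
def aut (D : Set (RelTuple r V)) : Subgroup (Perm V) where
  carrier := {g | ∀ t, g • t ∈ D ↔ t ∈ D}
  one_mem' := fun t => by rw [one_smul]
  mul_mem' := fun {g h} hg hh t => by rw [mul_smul, hg, hh]
  inv_mem' := fun {g} hg t => by rw [← hg, smul_inv_smul]

theorem mem_aut {D : Set (RelTuple r V)} {g : Perm V} : g ∈ aut D ↔ ∀ t, g • t ∈ D ↔ t ∈ D :=
  Iff.rfl

theorem smul_mk (g : Perm V) (i : ι) (x : Fin (r i) → V) :
    g • (⟨i, x⟩ : RelTuple r V) = ⟨i, fun j => g (x j)⟩ := rfl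

/-- The number of orbits of a permutation group on tuples. -/
noncomputable def numOrbits (r : ι → ℕ) (F : Subgroup (Perm V)) : ℕ :=
  Nat.card (MulAction.orbitRel.Quotient F (RelTuple r V))

theorem ncard_le_aut [Finite ι] [Finite V] (F : Subgroup (Perm V)) :
    {D : Set (RelTuple r V) | F ≤ aut D}.ncard = 2 ^ numOrbits r F := by
  rw [numOrbits, ← MulAction.ncard_invariant]
  congr 1
  ext D
  exact ⟨fun h g t => h g.2 t, fun h g hg t => h ⟨g, hg⟩ t⟩

theorem natCard_eq [Fintype ι] [Finite V] :
    Nat.card (RelTuple r V) = ∑ i, Nat.card V ^ r i := by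
  have := Fintype.ofFinite V
  simp [Nat.card_eq_fintype_card]

/-- The points moved by some element of the permutation group `F`. -/
def moved (F : Subgroup (Perm V)) : Set V := {v | ∃ g ∈ F, g v ≠ v}

theorem two_mul_numOrbits_add_le [Finite ι] [Finite V] (F : Subgroup (Perm V)) {i : ι}
    (hi : 1 ≤ r i) :
    2 * numOrbits r F + (moved F).ncard * Nat.card V ^ (r i - 1) ≤
      2 * Nat.card (RelTuple r V) := by
  obtain ⟨k, hk⟩ : ∃ k, r i = k + 1 := ⟨r i - 1, by omega⟩
  -- the tuples for `i` whose first entry is moved by `F`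
  let f : moved F × (Fin k → V) → RelTuple r V :=
    fun p => ⟨i, fun j => (Fin.cons p.1.1 p.2 : Fin (k + 1) → V) (Fin.cast hk j)⟩
  have hf : Function.Injective f := by
    rintro ⟨⟨v, hv⟩, x⟩ ⟨⟨w, hw⟩, y⟩ h
    have h1 := eq_of_heq (Sigma.mk.inj h).2
    have h2 : (Fin.cons v x : Fin (k + 1) → V) = Fin.cons w y := by
      ext j
      simpa using congrFun h1 (Fin.cast hk.symm j)
    obtain ⟨h3, h4⟩ := Fin.cons_inj.1 h2
    subst h3 h4
    rfl
  have h := MulAction.two_mul_card_orbits_add_le F (Set.range f) (by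
    rintro _ ⟨⟨⟨v, g, hg, hgv⟩, x⟩, rfl⟩
    refine ⟨⟨g, hg⟩, fun h => hgv ?_⟩
    have h1 := congrFun (eq_of_heq (Sigma.mk.inj h).2) (Fin.cast hk.symm 0)
    simpa [f] using h1)
  rw [← Set.image_univ, Set.ncard_image_of_injective _ hf, Set.ncard_univ, Nat.card_prod,
    Nat.card_fun, Nat.card_eq_fintype_card (α := Fin k), Fintype.card_fin,
    Nat.card_coe_set_eq] at h
  rw [hk, Nat.add_sub_cancel]
  exact h

/-- Transport of tuples along a bijection of the universes. -/
def congr (e : V ≃ W) : RelTuple r V ≃ RelTuple r W :=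
  Equiv.sigmaCongrRight fun _ => Equiv.arrowCongr (Equiv.refl _) e

theorem aut_congr_image (e : V ≃ W) (D : Set (RelTuple r V)) :
    aut (congr e '' D) = (aut D).map e.permCongrHom.toMonoidHom := by
  have key : ∀ (g : Perm V) (t : RelTuple r V), e.permCongr g • congr e t = congr e (g • t) := by
    rintro g ⟨i, x⟩
    change (⟨i, fun j => e (g (e.symm (e (x j))))⟩ : RelTuple r W) = ⟨i, fun j => e (g (x j))⟩
    simp only [Equiv.symm_apply_apply]
  have key' : ∀ g : Perm V, e.permCongr g ∈ aut (congr e '' D) ↔ g ∈ aut D := by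
    intro g
    rw [mem_aut, mem_aut, (congr e).surjective.forall]
    simp only [key, (congr e).injective.mem_set_image]
  ext g
  obtain ⟨g, rfl⟩ := e.permCongr.surjective g
  rw [key', Subgroup.mem_map]
  constructor
  · exact fun hg => ⟨g, hg, rfl⟩
  · rintro ⟨g', hg', h⟩
    rwa [← e.permCongr.injective h]

theorem ncard_aut_congr (e : V ≃ W) (Q : Subgroup (Perm W) → Prop) :
    {D : Set (RelTuple r W) | Q (aut D)}.ncard =
      {D : Set (RelTuple r V) | Q ((aut D).map e.permCongrHom.toMonoidHom)}.ncard := by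
  have hinj : Function.Injective fun D : Set (RelTuple r V) => congr e '' D :=
    (congr e).injective.image_injective
  rw [← Set.ncard_image_of_injective _ hinj]
  congr 1
  ext D
  constructor
  · intro h
    have hD : congr e '' ((congr e).symm '' D) = D := by simp [Set.image_image]
    refine ⟨(congr e).symm '' D, ?_, hD⟩
    change Q _
    rwa [← aut_congr_image, hD]
  · rintro ⟨D, h, rfl⟩
    change Q _
    rw [aut_congr_image]
    exact h

/-! ### Permutation groups with fixed points added -/

variable {A B : Type*}

/-- A permutation of `A` as a permutation of `A ⊕ B` that fixes `B` pointwise. -/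
def extendHom (A B : Type*) : Perm A →* Perm (A ⊕ B) :=
  (Equiv.Perm.sumCongrHom A B).comp (MonoidHom.inl _ _)

@[simp] theorem extendHom_inl (g : Perm A) (a : A) :
    extendHom A B g (Sum.inl a) = Sum.inl (g a) := rfl

@[simp] theorem extendHom_inr (g : Perm A) (b : B) :
    extendHom A B g (Sum.inr b) = Sum.inr b := rfl

theorem extendHom_injective : Function.Injective (extendHom A B) := by
  intro g h hgh
  ext a
  have := DFunLike.congr_fun hgh (Sum.inl a)
  simpa using this

theorem sum_pow_le_numOrbits [Fintype ι] [Finite A] [Finite B] (K : Subgroup (Perm A)) :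
    ∑ i, Nat.card B ^ r i ≤ numOrbits r (K.map (extendHom A B)) := by
  rw [← natCard_eq]
  let f : RelTuple r B → MulAction.orbitRel.Quotient (K.map (extendHom A B))
      (RelTuple r (A ⊕ B)) := fun t => Quotient.mk'' ⟨t.1, fun j => Sum.inr (t.2 j)⟩
  have : Finite (MulAction.orbitRel.Quotient (K.map (extendHom A B)) (RelTuple r (A ⊕ B))) :=
    Finite.of_surjective _ Quotient.mk''_surjective
  refine Nat.card_le_card_of_injective f ?_
  rintro ⟨i, x⟩ ⟨j, y⟩ h
  obtain ⟨⟨_, g, hgK, rfl⟩, hg⟩ := Quotient.exact h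
  have hg' : (⟨j, fun l => Sum.inr (y l)⟩ : RelTuple r (A ⊕ B)) = ⟨i, fun l => Sum.inr (x l)⟩ :=
    hg
  obtain ⟨rfl, h2⟩ := Sigma.mk.inj hg'
  have h3 := eq_of_heq h2
  congr 1
  ext l
  exact (Sum.inr_injective (congrFun h3 l)).symm

/-- Burnside's formula for the number of orbits on tuples. -/
theorem numOrbits_map_extendHom_mul [Fintype ι] [Finite A] [Finite B] (K : Subgroup (Perm A))
    [Fintype K] :
    numOrbits r (K.map (extendHom A B)) * Nat.card K =
      ∑ g : K, ∑ i, (Nat.card {a // g.1 a = a} + Nat.card B) ^ r i := by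
  classical
  have := Fintype.ofFinite A
  have := Fintype.ofFinite B
  let e := (K.equivMapOfInjective (extendHom A B) extendHom_injective)
  have := Fintype.ofEquiv K e.toEquiv
  have : Finite (MulAction.orbitRel.Quotient (K.map (extendHom A B)) (RelTuple r (A ⊕ B))) :=
    Finite.of_surjective _ Quotient.mk''_surjective
  have := Fintype.ofFinite (MulAction.orbitRel.Quotient (K.map (extendHom A B))
    (RelTuple r (A ⊕ B)))
  have h := MulAction.sum_card_fixedBy_eq_card_orbits_mul_card_group
    (K.map (extendHom A B)) (RelTuple r (A ⊕ B))
  rw [numOrbits, Nat.card_eq_fintype_card, Nat.card_congr e.toEquiv,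
    Nat.card_eq_fintype_card (α := (K.map (extendHom A B))), ← h,
    ← e.toEquiv.sum_comp]
  refine Finset.sum_congr rfl fun g _ => ?_
  -- the fixed tuples are the tuples of fixed points
  have e1 : MulAction.fixedBy (RelTuple r (A ⊕ B)) (e g) ≃
      RelTuple r ({a // g.1 a = a} ⊕ B) := by
    have hfix : ∀ v : A ⊕ B, extendHom A B g.1 v = v ↔
        ∃ w : {a // g.1 a = a} ⊕ B, Sum.map Subtype.val id w = v := by
      rintro (a | b)
      · simp
      · simp
    have hinj : Function.Injective
        (Sum.map Subtype.val id : {a // g.1 a = a} ⊕ B → A ⊕ B) :=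
      Subtype.val_injective.sumMap Function.injective_id
    refine (Equiv.ofBijective (fun t : RelTuple r ({a // g.1 a = a} ⊕ B) =>
      (⟨⟨t.1, fun j => Sum.map Subtype.val id (t.2 j)⟩, ?_⟩ :
        MulAction.fixedBy (RelTuple r (A ⊕ B)) (e g))) ⟨?_, ?_⟩).symm
    · change (⟨t.1, _⟩ : RelTuple r (A ⊕ B)) = ⟨t.1, _⟩
      congr 1
      ext1 j
      exact (hfix _).2 ⟨t.2 j, rfl⟩
    · rintro ⟨i, x⟩ ⟨j, y⟩ h
      obtain ⟨rfl, h2⟩ := Sigma.mk.inj (Subtype.mk.inj h)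
      congr 1
      ext1 l
      exact hinj (congrFun (eq_of_heq h2) l)
    · rintro ⟨⟨i, x⟩, hx⟩
      have hx' : ∀ j, extendHom A B g.1 (x j) = x j := fun j =>
        congrFun (eq_of_heq (Sigma.mk.inj hx).2) j
      choose y hy using fun j => (hfix _).1 (hx' j)
      refine ⟨⟨i, y⟩, Subtype.ext ?_⟩
      change (⟨i, _⟩ : RelTuple r (A ⊕ B)) = ⟨i, _⟩
      congr 1
      ext1 j
      exact hy j
  rw [← Nat.card_eq_fintype_card]
  change Nat.card (MulAction.fixedBy (RelTuple r (A ⊕ B)) (e g)) = _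
  rw [Nat.card_congr e1, natCard_eq, Nat.card_sum]

end RelTuple

/-! ### Structures whose automorphisms move many points are rare -/

namespace RelTuple

open Equiv (Perm)

variable {ι : Type*} {r : ι → ℕ} {V : Type*}

theorem card_perm_fixing_compl_le [Finite V] (Y : Set V) :
    Nat.card {g : Perm V // ∀ v, v ∉ Y → g v = v} ≤ Nat.card V ^ Y.ncard := by
  classical
  have := Fintype.ofFinite V
  rw [← Nat.card_congr (Perm.subtypeEquivSubtypePerm (· ∈ Y)), Nat.card_perm]
  refine (Nat.factorial_le_pow _).trans ?_
  rw [Nat.card_coe_set_eq]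
  exact Nat.pow_le_pow_left (Set.ncard_le_card Y) _

theorem two_pow_numOrbits_le [Finite ι] [Finite V] (F : Subgroup (Perm V)) {i : ι}
    (hi : 1 ≤ r i) :
    (2 : ℝ) ^ numOrbits r F ≤ 2 ^ Nat.card (RelTuple r V) *
      ((2 : ℝ) ^ (-((Nat.card V : ℝ) ^ (r i - 1) / 2))) ^ (moved F).ncard := by
  have h : (2 * numOrbits r F + (moved F).ncard * Nat.card V ^ (r i - 1) : ℝ) ≤
      2 * Nat.card (RelTuple r V) := by exact_mod_cast two_mul_numOrbits_add_le F hi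
  rw [← Real.rpow_natCast, ← Real.rpow_natCast _ (Nat.card (RelTuple r V)),
    ← Real.rpow_natCast _ (moved F).ncard, ← Real.rpow_mul (by norm_num),
    ← Real.rpow_add (by norm_num)]
  refine Real.rpow_le_rpow_of_exponent_le (by norm_num) ?_
  linarith

/-- A structure whose automorphisms move more than `m` points is invariant under some `m + 1`
permutations that move at least `m + 1` points altogether. There are at most
`n ^ (y * (m + 2))` choices of such permutations moving `y` points in all, while invariance under
them divides the number of structures by at least `2 ^ (y * n ^ (r i - 1) / 2)`. -/
theorem ncard_lt_moved_aut_le [Finite ι] [Finite V] (m : ℕ) {i : ι} (hi : 1 ≤ r i)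
    (h : (Nat.card V : ℝ) ^ (m + 3) ≤ 2 ^ ((Nat.card V : ℝ) ^ (r i - 1) / 4)) :
    ({D : Set (RelTuple r V) | m < (moved (aut D)).ncard}.ncard : ℝ) ≤
      2 ^ Nat.card (RelTuple r V) * ((2 : ℝ) ^ (-((Nat.card V : ℝ) ^ (r i - 1) / 4))) ^ m := by
  classical
  have := Fintype.ofFinite V
  set n := Nat.card V with hn
  set N : ℝ := (n : ℝ) ^ (r i - 1) with hN
  set x : ℝ := (2 : ℝ) ^ (-(N / 2)) with hx
  set T := Nat.card (RelTuple r V) with hT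
  have hx0 : 0 < x := by positivity
  let cl : (Fin (m + 1) → Perm V) → Subgroup (Perm V) := fun g => Subgroup.closure (Set.range g)
  let J : Finset (Fin (m + 1) → Perm V) := Finset.univ.filter fun g => m < (moved (cl g)).ncard
  have h1 : {D : Set (RelTuple r V) | m < (moved (aut D)).ncard}.ncard ≤
      ∑ g ∈ J, {D : Set (RelTuple r V) | cl g ≤ aut D}.ncard := by
    refine Set.ncard_le_sum_of_forall_exists _ _ _ fun D hD => ?_
    obtain ⟨Z, hZ, hZc⟩ := Set.exists_subset_card_eq (s := moved (aut D)) (n := m + 1) hD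
    have eZ : Fin (m + 1) ≃ Z := (Finite.equivFinOfCardEq (by rw [Nat.card_coe_set_eq, hZc])).symm
    choose g hg hgv using fun j => hZ (eZ j).2
    refine ⟨g, ?_, ?_⟩
    · simp only [J, Finset.mem_filter, Finset.mem_univ, true_and]
      have hsub : Z ⊆ moved (cl g) := fun z hz =>
        ⟨g (eZ.symm ⟨z, hz⟩), Subgroup.subset_closure ⟨_, rfl⟩, by
          simpa using hgv (eZ.symm ⟨z, hz⟩)⟩
      have := Set.ncard_le_ncard hsub
      omega
    · change cl g ≤ aut D
      rw [Subgroup.closure_le]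
      rintro _ ⟨j, rfl⟩
      exact hg j
  have h2 : ∀ Y : Finset V, ((J.filter fun g => (moved (cl g)).toFinset = Y).card : ℝ) ≤
      ((n : ℝ) ^ (m + 1)) ^ Y.card := by
    intro Y
    have hcard : (J.filter fun g => (moved (cl g)).toFinset = Y).card ≤
        Nat.card (Fin (m + 1) → {g : Perm V // ∀ v, v ∉ (Y : Set V) → g v = v}) := by
      rw [← Nat.card_eq_finsetCard]
      refine Nat.card_le_card_of_injective
        (fun g j => ⟨g.1 j, fun v hv => ?_⟩) fun g g' hgg => ?_
      · by_contra hne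
        have hg := (Finset.mem_filter.1 g.2).2
        refine hv ?_
        rw [Finset.mem_coe, ← hg, Set.mem_toFinset]
        exact ⟨g.1 j, Subgroup.subset_closure ⟨_, rfl⟩, hne⟩
      · refine Subtype.ext (funext fun j => ?_)
        exact Subtype.mk.inj (congrFun hgg j)
    have hcard2 := card_perm_fixing_compl_le (Y : Set V)
    rw [Set.ncard_coe_finset] at hcard2
    rw [Nat.card_fun, Nat.card_eq_fintype_card (α := Fin (m + 1)), Fintype.card_fin] at hcard
    have := hcard.trans (Nat.pow_le_pow_left hcard2 _)
    rw [← pow_mul, mul_comm, pow_mul] at this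
    exact_mod_cast this
  have h3 : ({D : Set (RelTuple r V) | m < (moved (aut D)).ncard}.ncard : ℝ) ≤
      ∑ Y : Finset V, if m < Y.card then 2 ^ T * ((n : ℝ) ^ (m + 1) * x) ^ Y.card else 0 := by
    calc ({D : Set (RelTuple r V) | m < (moved (aut D)).ncard}.ncard : ℝ)
        ≤ ∑ g ∈ J, (2 : ℝ) ^ T * x ^ (moved (cl g)).ncard := by
          refine (Nat.cast_le.2 h1).trans ?_
          push_cast
          refine Finset.sum_le_sum fun g _ => ?_
          rw [ncard_le_aut]
          push_cast
          exact two_pow_numOrbits_le (cl g) hi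
      _ = ∑ Y : Finset V, ∑ g ∈ J.filter fun g => (moved (cl g)).toFinset = Y,
            (2 : ℝ) ^ T * x ^ (moved (cl g)).ncard :=
          (Finset.sum_fiberwise _ _ _).symm
      _ ≤ _ := by
          refine Finset.sum_le_sum fun Y _ => ?_
          have hY : ∀ g ∈ J.filter fun g => (moved (cl g)).toFinset = Y,
              m < Y.card ∧ (moved (cl g)).ncard = Y.card := by
            intro g hg
            obtain ⟨hg1, rfl⟩ := Finset.mem_filter.1 hg
            rw [← Set.ncard_eq_toFinset_card']
            exact ⟨(Finset.mem_filter.1 hg1).2, rfl⟩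
          split_ifs with hm
          · rw [Finset.sum_congr rfl fun g hg => by rw [(hY g hg).2], Finset.sum_const,
              nsmul_eq_mul, mul_pow]
            calc _ ≤ ((n : ℝ) ^ (m + 1)) ^ Y.card * (2 ^ T * x ^ Y.card) := by
                  gcongr
                  exact h2 Y
              _ = _ := by ring
          · rw [Finset.sum_eq_zero]
            intro g hg
            exact absurd (hY g hg).1 hm
  set z : ℝ := (n : ℝ) ^ (m + 2) * x with hz
  have hz0 : 0 ≤ z := by positivity
  have hnz : n * z ≤ (2 : ℝ) ^ (-(N / 4)) := by
    calc n * z = (n : ℝ) ^ (m + 3) * x := by rw [hz]; ring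
      _ ≤ 2 ^ (N / 4) * x := by gcongr
      _ = _ := by
        rw [hx, ← Real.rpow_add (by norm_num)]
        congr 1
        ring
  have hN0 : 0 ≤ N := by positivity
  have hle1 : (2 : ℝ) ^ (-(N / 4)) ≤ 1 :=
    Real.rpow_le_one_of_one_le_of_nonpos (by norm_num) (by linarith)
  rcases Nat.eq_zero_or_pos n with hn0 | hn0
  · -- on the empty set no point is moved
    have hemp : {D : Set (RelTuple r V) | m < (moved (aut D)).ncard} = ∅ := by
      ext D
      have := Set.ncard_le_card (moved (aut D))
      simp only [Set.mem_ofPred_eq, Set.mem_empty_iff_false, iff_false, not_lt]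
      omega
    rw [hemp, Set.ncard_empty]
    push_cast
    positivity
  have hn1 : (1 : ℝ) ≤ n := by exact_mod_cast hn0
  have hz1 : z ≤ (2 : ℝ) ^ (-(N / 4)) := (le_mul_of_one_le_left hz0 hn1).trans hnz
  have h4 : ∀ y ∈ Finset.range (n + 1), n.choose y •
      (if m < y then (2 : ℝ) ^ T * ((n : ℝ) ^ (m + 1) * x) ^ y else 0) ≤
        if m < y then 2 ^ T * z ^ (m + 1) else 0 := by
    intro y _
    split_ifs with hy
    · rw [nsmul_eq_mul]
      have hch : ((n.choose y : ℕ) : ℝ) ≤ (n : ℝ) ^ y := by exact_mod_cast Nat.choose_le_pow n y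
      calc ((n.choose y : ℕ) : ℝ) * ((2 : ℝ) ^ T * ((n : ℝ) ^ (m + 1) * x) ^ y)
          ≤ (n : ℝ) ^ y * ((2 : ℝ) ^ T * ((n : ℝ) ^ (m + 1) * x) ^ y) := by gcongr
        _ = 2 ^ T * z ^ y := by rw [hz]; ring
        _ ≤ 2 ^ T * z ^ (m + 1) := by
          gcongr 2 ^ T * ?_
          exact pow_le_pow_of_le_one hz0 (hz1.trans hle1) hy
    · simp
  refine h3.trans ?_
  have h5 := Finset.sum_powerset_apply_card (fun y => if m < y then
    (2 : ℝ) ^ T * ((n : ℝ) ^ (m + 1) * x) ^ y else 0) (x := (Finset.univ : Finset V))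
  have h6 : (Finset.univ : Finset V).card = n := by
    rw [hn, Nat.card_eq_fintype_card, Finset.card_univ]
  rw [Finset.powerset_univ, h6] at h5
  rw [h5]
  refine (Finset.sum_le_sum h4).trans ?_
  rw [← Finset.sum_filter, Finset.sum_const, nsmul_eq_mul]
  have h7 : ((Finset.range (n + 1)).filter fun y => m < y).card ≤ n := by
    calc _ ≤ (Finset.Ioc 0 n).card := by
          refine Finset.card_le_card fun y hy => ?_
          simp only [Finset.mem_filter, Finset.mem_range, Finset.mem_Ioc] at hy ⊢
          omega
      _ = n := by simp
  calc _ ≤ (n : ℝ) * (2 ^ T * z ^ (m + 1)) := by gcongr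
    _ = 2 ^ T * z ^ m * (n * z) := by ring
    _ ≤ 2 ^ T * ((2 : ℝ) ^ (-(N / 4))) ^ m * 1 := by
      gcongr
      exact hnz.trans hle1
    _ = _ := mul_one _

theorem eventually_pow_le_two_rpow (k : ℕ) :
    ∀ᶠ n : ℕ in atTop, (n : ℝ) ^ k ≤ 2 ^ ((n : ℝ) / 4) := by
  have h := tendsto_pow_mul_two_rpow_neg k (c := 1 / 4) (by norm_num)
  filter_upwards [h.eventually_le_const one_pos] with n hn
  rw [Real.rpow_neg (by norm_num), mul_inv_le_iff₀ (by positivity), one_mul] at hn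
  rwa [div_eq_inv_mul, ← one_div]

/-- For every `C` there is an `m` such that the structures whose automorphisms move more than `m`
points make up a proportion of at most `2 ^ (-(C * n ^ (r i - 1) + n))` of all structures, for all
large `n`. -/
theorem exists_ncard_lt_moved_aut_mul_le [Finite ι] {i : ι} (hi : 2 ≤ r i) (C : ℕ) :
    ∃ m : ℕ, ∀ᶠ n : ℕ in atTop, ∀ (V : Type) [Finite V], Nat.card V = n →
      {D : Set (RelTuple r V) | m < (moved (aut D)).ncard}.ncard *
        2 ^ (C * n ^ (r i - 1) + n) ≤ 2 ^ Nat.card (RelTuple r V) := by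
  refine ⟨4 * (C + 1), ?_⟩
  filter_upwards [eventually_pow_le_two_rpow (4 * (C + 1) + 3), eventually_ge_atTop 1] with
    n hn hn1 V _ hV
  subst hV
  have hn1' : (1 : ℝ) ≤ Nat.card V := by exact_mod_cast hn1
  have hnN : (Nat.card V : ℝ) ≤ (Nat.card V : ℝ) ^ (r i - 1) :=
    le_self_pow₀ hn1' (by omega)
  have h1 := ncard_lt_moved_aut_le (r := r) (V := V) (4 * (C + 1)) (i := i) (by omega)
    (hn.trans (by gcongr; norm_num))
  set N : ℝ := (Nat.card V : ℝ) ^ (r i - 1) with hN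
  have h2 : ((2 : ℝ) ^ (-(N / 4))) ^ (4 * (C + 1)) * 2 ^ (C * Nat.card V ^ (r i - 1) + Nat.card V)
      ≤ 1 := by
    rw [← Real.rpow_natCast, ← Real.rpow_natCast, ← Real.rpow_mul (by norm_num),
      ← Real.rpow_add (by norm_num)]
    refine Real.rpow_le_one_of_one_le_of_nonpos (by norm_num) ?_
    push_cast
    rw [← hN]
    linarith
  have h3 : ({D : Set (RelTuple r V) | 4 * (C + 1) < (moved (aut D)).ncard}.ncard : ℝ) *
      2 ^ (C * Nat.card V ^ (r i - 1) + Nat.card V) ≤ 2 ^ Nat.card (RelTuple r V) := by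
    calc _ ≤ 2 ^ Nat.card (RelTuple r V) * ((2 : ℝ) ^ (-(N / 4))) ^ (4 * (C + 1)) *
          2 ^ (C * Nat.card V ^ (r i - 1) + Nat.card V) := by gcongr
      _ ≤ 2 ^ Nat.card (RelTuple r V) * 1 := by
        rw [mul_assoc]
        gcongr
      _ = _ := mul_one _
  exact_mod_cast h3

end RelTuple

/-! ### Structures with a prescribed automorphism group on a fixed finite set -/

namespace RelTuple

open Equiv (Perm)

variable {ι : Type*} {r : ι → ℕ} {A B : Type*}

/-- The permutations of `A` that, extended by the identity on `B`, are automorphisms of `D`. -/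
def restrAut (D : Set (RelTuple r (A ⊕ B))) : Subgroup (Perm A) := (aut D).comap (extendHom A B)

theorem le_restrAut_iff {K : Subgroup (Perm A)} {D : Set (RelTuple r (A ⊕ B))} :
    K ≤ restrAut D ↔ K.map (extendHom A B) ≤ aut D := Subgroup.map_le_iff_le_comap.symm

variable (r) in
/-- The number of structures on `A ⊕ Fin t` invariant under `K`. -/
noncomputable def invCount (K : Subgroup (Perm A)) (t : ℕ) : ℕ :=
  {D : Set (RelTuple r (A ⊕ Fin t)) | K ≤ restrAut D}.ncard

variable (r) in
/-- The number of structures on `A ⊕ Fin t` whose automorphisms fixing `Fin t` pointwise form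
the group `K`. -/
noncomputable def restrCount (K : Subgroup (Perm A)) (t : ℕ) : ℕ :=
  {D : Set (RelTuple r (A ⊕ Fin t)) | restrAut D = K}.ncard

variable (r) in
/-- The number of structures on `A ⊕ Fin t` whose automorphisms are the elements of `K`, extended
by the identity on `Fin t`. -/
noncomputable def autCount (K : Subgroup (Perm A)) (t : ℕ) : ℕ :=
  {D : Set (RelTuple r (A ⊕ Fin t)) | aut D = K.map (extendHom A (Fin t))}.ncard

theorem invCount_eq [Finite ι] [Finite A] (K : Subgroup (Perm A)) (t : ℕ) :
    invCount r K t = 2 ^ numOrbits r (K.map (extendHom A (Fin t))) := by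
  rw [← ncard_le_aut, invCount]
  simp only [le_restrAut_iff]

theorem invCount_pos [Finite ι] [Finite A] (K : Subgroup (Perm A)) (t : ℕ) :
    (0 : ℝ) < invCount r K t := by
  rw [invCount_eq]
  positivity

theorem eventuallyPolynomial_numOrbits [Finite ι] [Finite A] (K : Subgroup (Perm A)) :
    EventuallyPolynomial fun t => (numOrbits r (K.map (extendHom A (Fin t))) : ℤ) := by
  have := Fintype.ofFinite ι
  have := Fintype.ofFinite K
  refine ⟨Polynomial.C ((Nat.card K : ℝ)⁻¹) * ∑ g : K, ∑ i,
    (Polynomial.C (Nat.card {a // g.1 a = a} : ℝ) + Polynomial.X) ^ r i,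
    Eventually.of_forall fun t => ?_⟩
  have h := numOrbits_map_extendHom_mul (r := r) (B := Fin t) K
  rw [Nat.card_eq_fintype_card (α := Fin t), Fintype.card_fin] at h
  have h' : (numOrbits r (K.map (extendHom A (Fin t))) : ℝ) * Nat.card K =
      ∑ g : K, ∑ i, ((Nat.card {a // g.1 a = a} : ℝ) + t) ^ r i := by exact_mod_cast h
  have hK : (Nat.card K : ℝ) ≠ 0 := by exact_mod_cast Nat.card_pos.ne'
  simp only [Polynomial.eval_mul, Polynomial.eval_C, Polynomial.eval_finsetSum,
    Polynomial.eval_pow, Polynomial.eval_add, Polynomial.eval_X, ← h']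
  push_cast
  field_simp

theorem hasGrowth_invCount [Finite ι] [Finite A] (K : Subgroup (Perm A)) :
    HasGrowth fun t => (invCount r K t : ℝ) := by
  refine ⟨1, 0, _, one_pos, eventuallyPolynomial_numOrbits (r := r) K, ?_⟩
  push_cast
  refine tendsto_const_nhds.congr fun t => ?_
  rw [invCount_eq, growth, pow_zero, one_mul, zpow_natCast]
  push_cast
  rw [div_self (by positivity)]

theorem invCount_anti [Finite ι] [Finite A] {K K' : Subgroup (Perm A)} (h : K ≤ K') (t : ℕ) :
    invCount r K' t ≤ invCount r K t := by
  unfold invCount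
  exact Set.ncard_le_ncard fun _ hD => h.trans hD

theorem tendsto_invCount_div [Finite ι] [Finite A] {K K' : Subgroup (Perm A)} (h : K ≤ K') :
    ∃ q : ℚ, Tendsto (fun t => (invCount r K' t : ℝ) / invCount r K t) atTop (𝓝 (q : ℝ)) := by
  rcases (hasGrowth_invCount (r := r) K').comparison (hasGrowth_invCount (r := r) K) with
    ⟨q, -, hq⟩ | hq | hq
  · exact ⟨q, hq⟩
  · exact ⟨0, by simpa using hq⟩
  · have h1 : ∀ t, (1 : ℝ) ≤ invCount r K t / invCount r K' t := fun t =>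
      (one_le_div (invCount_pos (r := r) K' t)).2 (by exact_mod_cast invCount_anti (r := r) h t)
    exact absurd (ge_of_tendsto' hq h1) (by norm_num)

theorem invCount_eq_sum [Finite ι] [Finite A] [Fintype (Subgroup (Perm A))]
    [DecidableLE (Subgroup (Perm A))] (K : Subgroup (Perm A)) (t : ℕ) :
    invCount r K t = ∑ K' ∈ Finset.univ.filter (K ≤ ·), restrCount r K' t := by
  rw [invCount, Set.ncard_eq_sum_ncard_fiber _ restrAut (Finset.univ.filter (K ≤ ·))
    (fun D hD => by simpa using hD)]
  refine Finset.sum_congr rfl fun K' hK' => ?_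
  rw [restrCount]
  congr 1
  ext D
  refine ⟨fun h => h.2, fun h => ⟨?_, h⟩⟩
  change K ≤ restrAut D
  rw [show restrAut D = K' from h]
  simpa using hK'

/-- Among the structures invariant under `K`, the proportion of those with no further
automorphisms on `A` has a rational limit. -/
theorem tendsto_restrCount_div [Finite ι] [Finite A] (K : Subgroup (Perm A)) :
    ∃ c : ℚ, Tendsto (fun t => (restrCount r K t : ℝ) / invCount r K t) atTop (𝓝 (c : ℝ)) := by
  classical
  have := Fintype.ofFinite (Subgroup (Perm A))
  induction K using WellFoundedGT.induction with
  | ind K ih =>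
    have h1 : ∀ K' : Subgroup (Perm A), ∃ c : ℚ, K < K' →
        Tendsto (fun t => (restrCount r K' t : ℝ) / invCount r K t) atTop (𝓝 (c : ℝ)) := by
      intro K'
      by_cases hK : K < K'
      · obtain ⟨c, hc⟩ := ih K' hK
        obtain ⟨q, hq⟩ := tendsto_invCount_div (r := r) hK.le
        refine ⟨c * q, fun _ => ?_⟩
        push_cast
        refine (hc.mul hq).congr fun t => ?_
        have := (invCount_pos (r := r) K' t).ne'
        field_simp
      · exact ⟨0, fun h => absurd h hK⟩
    choose c hc using h1
    refine ⟨1 - ∑ K' ∈ Finset.univ.filter (K < ·), c K', ?_⟩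
    push_cast
    have h2 := (tendsto_const_nhds (x := (1 : ℝ))).sub (tendsto_finsetSum
      (Finset.univ.filter (K < ·)) fun K' hK' => hc K' (by simpa using hK'))
    refine h2.congr fun t => ?_
    have h3 : (invCount r K t : ℝ) =
        restrCount r K t + ∑ K' ∈ Finset.univ.filter (K < ·), (restrCount r K' t : ℝ) := by
      rw [invCount_eq_sum]
      have h4 : Finset.univ.filter (K ≤ ·) = insert K (Finset.univ.filter (K < ·)) := by
        ext K'
        simp [le_iff_eq_or_lt, eq_comm]
      rw [h4, Finset.sum_insert (by simp)]
      push_cast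
      rfl
    have h5 := (invCount_pos (r := r) K t).ne'
    rw [← Finset.sum_div]
    field_simp
    linarith

/-- Tuples over `A ⊕ B₀` as tuples over `A ⊕ B`. -/
def mapRight (A : Type*) {B₀ B : Type*} (j : B₀ → B) (t : RelTuple r (A ⊕ B₀)) :
    RelTuple r (A ⊕ B) :=
  ⟨t.1, fun l => Sum.map id j (t.2 l)⟩

theorem mapRight_injective {B₀ : Type*} {j : B₀ → B} (hj : Function.Injective j) :
    Function.Injective (mapRight (r := r) A j) := by
  rintro ⟨i, x⟩ ⟨i', y⟩ h
  obtain ⟨rfl, h2⟩ := Sigma.mk.inj h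
  congr 1
  ext1 l
  exact (Function.injective_id.sumMap hj) (congrFun (eq_of_heq h2) l)

theorem smul_mapRight {B₀ : Type*} (j : B₀ → B) (g : Perm A) (t : RelTuple r (A ⊕ B₀)) :
    extendHom A B g • mapRight A j t = mapRight A j (extendHom A B₀ g • t) := by
  obtain ⟨i, x⟩ := t
  change (⟨i, _⟩ : RelTuple r (A ⊕ B)) = ⟨i, _⟩
  congr 1
  ext1 l
  change extendHom A B g (Sum.map id j (x l)) = Sum.map id j (extendHom A B₀ g (x l))
  rcases x l with a | b <;> rfl

/-- Replacing the part of a `K`-invariant structure on `A ⊕ Fin t₀` by a structure in which the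
automorphisms fixing `Fin t₀` form the group `K` leaves no other automorphisms on `A`. -/
theorem invCount_le_mul_restrCount [Finite ι] [Finite A] {K : Subgroup (Perm A)} {t₀ t : ℕ}
    (ht : t₀ ≤ t) (h : restrCount r K t₀ ≠ 0) :
    invCount r K t ≤ invCount r K t₀ * restrCount r K t := by
  obtain ⟨D₀, hD₀⟩ := Set.nonempty_of_ncard_ne_zero h
  set f : RelTuple r (A ⊕ Fin t₀) → RelTuple r (A ⊕ Fin t) := mapRight A (Fin.castLE ht) with hf
  have hfi : Function.Injective f := mapRight_injective (Fin.castLE_injective ht)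
  have hsm : ∀ g x, extendHom A (Fin t) g • f x = f (extendHom A (Fin t₀) g • x) :=
    smul_mapRight _
  have hmem : ∀ (D : Set (RelTuple r (A ⊕ Fin t))) x, f x ∈ (D \ Set.range f) ∪ f '' D₀ ↔
      x ∈ D₀ := by
    intro D x
    simp [hfi.eq_iff]
  have hmem' : ∀ (D : Set (RelTuple r (A ⊕ Fin t))) y, y ∉ Set.range f →
      (y ∈ (D \ Set.range f) ∪ f '' D₀ ↔ y ∈ D) := by
    intro D y hy
    constructor
    · rintro (h | ⟨x, -, rfl⟩)
      · exact h.1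
      · exact absurd ⟨x, rfl⟩ hy
    · exact fun h => Or.inl ⟨h, hy⟩
  have hrange : ∀ (g : Perm A) y, y ∉ Set.range f → extendHom A (Fin t) g • y ∉ Set.range f := by
    rintro g y hy ⟨x, hx⟩
    refine hy ⟨extendHom A (Fin t₀) g⁻¹ • x, ?_⟩
    rw [← hsm, hx, map_inv, inv_smul_smul]
  let Φ : {D : Set (RelTuple r (A ⊕ Fin t)) | K ≤ restrAut D} →
      {D : Set (RelTuple r (A ⊕ Fin t₀)) | K ≤ restrAut D} ×
        {D : Set (RelTuple r (A ⊕ Fin t)) | restrAut D = K} :=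
    fun D => (⟨f ⁻¹' D.1, fun g hg x => by
        simp only [Set.mem_preimage, ← hsm]
        exact D.2 hg (f x)⟩,
      ⟨(D.1 \ Set.range f) ∪ f '' D₀, le_antisymm
        (fun g hg => by
          rw [← show restrAut D₀ = K from hD₀]
          intro x
          have := hg (f x)
          rwa [hsm, hmem, hmem] at this)
        (fun g hg y => by
          by_cases hy : y ∈ Set.range f
          · obtain ⟨x, rfl⟩ := hy
            rw [hsm, hmem, hmem]
            rw [← show restrAut D₀ = K from hD₀] at hg
            exact hg x
          · rw [hmem' _ _ hy, hmem' _ _ (hrange g y hy)]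
            exact D.2 hg y)⟩)
  have hΦ : Function.Injective Φ := by
    rintro ⟨D, hD⟩ ⟨D', hD'⟩ h
    obtain ⟨h1, h2⟩ := Prod.mk.inj h
    have h1 := Subtype.mk.inj h1
    have h2 := Subtype.mk.inj h2
    refine Subtype.ext (Set.ext fun y => ?_)
    change y ∈ D ↔ y ∈ D'
    by_cases hy : y ∈ Set.range f
    · obtain ⟨x, rfl⟩ := hy
      exact Set.ext_iff.1 h1 x
    · rw [← hmem' D y hy, ← hmem' D' y hy, h2]
  have := Nat.card_le_card_of_injective Φ hΦ
  rwa [Nat.card_prod, Nat.card_coe_set_eq, Nat.card_coe_set_eq, Nat.card_coe_set_eq] at this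

/-- The limit in `tendsto_restrCount_div` is positive as soon as the automorphisms on `A` of some
structure form exactly the group `K`. -/
theorem exists_pos_tendsto_restrCount_div [Finite ι] [Finite A] {K : Subgroup (Perm A)} {t₀ : ℕ}
    (h : restrCount r K t₀ ≠ 0) : ∃ c : ℚ, 0 < c ∧
      Tendsto (fun t => (restrCount r K t : ℝ) / invCount r K t) atTop (𝓝 (c : ℝ)) := by
  obtain ⟨c, hc⟩ := tendsto_restrCount_div (r := r) K
  refine ⟨c, ?_, hc⟩
  have h1 : (1 : ℝ) / invCount r K t₀ ≤ c := by
    refine ge_of_tendsto hc ?_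
    filter_upwards [eventually_ge_atTop t₀] with t ht
    have h2 : (invCount r K t : ℝ) ≤ invCount r K t₀ * restrCount r K t := by
      exact_mod_cast invCount_le_mul_restrCount ht h
    rw [div_le_div_iff₀ (invCount_pos K t₀) (invCount_pos K t)]
    linarith
  have h2 : (0 : ℝ) < c := (one_div_pos.2 (invCount_pos K t₀)).trans_le h1
  exact_mod_cast h2

/-! ### Automorphisms that move points outside a fixed finite set -/

theorem add_pow_le_pow_add (t s k : ℕ) : (t + s) ^ k ≤ t ^ k + k * s * (t + s) ^ (k - 1) := by
  induction k with
  | zero => simp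
  | succ k ih =>
    rcases Nat.eq_zero_or_pos k with rfl | hk
    · simp
    have h1 : (t + s) ^ k = (t + s) * (t + s) ^ (k - 1) := by
      rw [← pow_succ', Nat.sub_add_cancel hk]
    have h2 : t * (k * s * (t + s) ^ (k - 1)) ≤ k * s * (t + s) ^ k := by
      rw [h1]
      calc _ = k * s * (t * (t + s) ^ (k - 1)) := by ring
        _ ≤ _ := by gcongr; omega
    calc (t + s) ^ (k + 1) = t * (t + s) ^ k + s * (t + s) ^ k := by ring
      _ ≤ t * (t ^ k + k * s * (t + s) ^ (k - 1)) + s * (t + s) ^ k := by gcongr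
      _ ≤ t ^ (k + 1) + (k + 1) * s * (t + s) ^ k := by
        rw [mul_add, add_mul, add_mul, one_mul, pow_succ']
        omega

/-- If `i` has the maximal arity, then all but `O(n ^ (r i - 1))` of the tuples on `A ⊕ Fin t`
are fixed by the permutations of `A`. -/
theorem exists_two_pow_card_le [Finite ι] [Finite A] {i : ι} (hi : ∀ j, r j ≤ r i)
    (K : Subgroup (Perm A)) : ∃ C : ℕ, ∀ t, 1 ≤ t →
      2 ^ Nat.card (RelTuple r (A ⊕ Fin t)) ≤
        invCount r K t * 2 ^ (C * (Nat.card A + t) ^ (r i - 1)) := by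
  have := Fintype.ofFinite ι
  refine ⟨∑ j, r j * Nat.card A, fun t ht => ?_⟩
  rw [invCount_eq, ← pow_add]
  refine Nat.pow_le_pow_right two_pos ?_
  have h1 := sum_pow_le_numOrbits (r := r) (B := Fin t) K
  rw [Nat.card_eq_fintype_card (α := Fin t), Fintype.card_fin] at h1
  refine le_trans ?_ (Nat.add_le_add_right h1 _)
  rw [natCard_eq, Nat.card_sum, Nat.card_eq_fintype_card (α := Fin t), Fintype.card_fin,
    Finset.sum_mul, ← Finset.sum_add_distrib]
  refine Finset.sum_le_sum fun j _ => ?_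
  rw [add_comm (Nat.card A) t]
  refine (add_pow_le_pow_add t (Nat.card A) (r j)).trans ?_
  gcongr
  · omega
  · exact hi j

/-- A permutation `g` that moves a point `b` of `B` joins the orbits of the tuples
`(b, z, …, z)` and `(g b, z, …, z)` for the points `z` of `B` it fixes. -/
theorem numOrbits_sup_zpowers_add_le [Finite ι] [Finite A] [Finite B] (K : Subgroup (Perm A))
    {i : ι} (hi : 2 ≤ r i) (g : Perm (A ⊕ B)) (b : B) (hb : g (Sum.inr b) ≠ Sum.inr b) :
    numOrbits r (K.map (extendHom A B) ⊔ Subgroup.zpowers g) +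
      Nat.card {z : B // g (Sum.inr z) = Sum.inr z} ≤ numOrbits r (K.map (extendHom A B)) := by
  have hgmem : g ∈ K.map (extendHom A B) ⊔ Subgroup.zpowers g :=
    Subgroup.mem_sup_right (Subgroup.mem_zpowers g)
  have hfix : ∀ f ∈ K.map (extendHom A B), ∀ z : B, f (Sum.inr z) = Sum.inr z := by
    rintro _ ⟨f, -, rfl⟩ z
    rfl
  refine MulAction.card_orbits_add_card_le (T := RelTuple r (A ⊕ B))
    (Z := {z : B // g (Sum.inr z) = Sum.inr z}) le_sup_left
    (fun z => ⟨i, fun j => if j.1 = 0 then Sum.inr b else Sum.inr z.1⟩)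
    (fun z => g • ⟨i, fun j => if j.1 = 0 then Sum.inr b else Sum.inr z.1⟩) ?_ ?_
    (fun z => ⟨g, hgmem, rfl⟩)
  · rintro z z' ⟨f, hf, h⟩
    have h1 := congrFun (eq_of_heq (Sigma.mk.inj h).2) ⟨1, hi⟩
    change f (if (1 : ℕ) = 0 then Sum.inr b else Sum.inr z.1) =
      if (1 : ℕ) = 0 then Sum.inr b else Sum.inr z'.1 at h1
    simp only [one_ne_zero, if_false, hfix f hf] at h1
    exact Subtype.ext (Sum.inr_injective h1)
  · intro z z' f hf h
    have h1 := congrFun (eq_of_heq (Sigma.mk.inj h).2) ⟨0, two_pos.trans_le hi⟩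
    change f (g (if (0 : ℕ) = 0 then Sum.inr b else Sum.inr z.1)) =
      if (0 : ℕ) = 0 then Sum.inr b else Sum.inr z'.1 at h1
    simp only [if_true] at h1
    exact hb (f.injective (h1.trans (hfix f hf b).symm))

theorem ncard_invariant_moving_le [Finite ι] [Finite A] (K : Subgroup (Perm A)) {i : ι}
    (hi : 2 ≤ r i) {t m : ℕ} (g : Perm (A ⊕ Fin t)) (b : Fin t)
    (hb : g (Sum.inr b) ≠ Sum.inr b) (hm : {v | g v ≠ v}.ncard ≤ m) :
    {D : Set (RelTuple r (A ⊕ Fin t)) | K ≤ restrAut D ∧ g ∈ aut D}.ncard * 2 ^ t ≤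
      invCount r K t * 2 ^ m := by
  have h1 : {D : Set (RelTuple r (A ⊕ Fin t)) | K ≤ restrAut D ∧ g ∈ aut D} =
      {D | K.map (extendHom A (Fin t)) ⊔ Subgroup.zpowers g ≤ aut D} := by
    ext D
    simp [le_restrAut_iff]
  have h2 := numOrbits_sup_zpowers_add_le (r := r) K hi g b hb
  have h3 : t ≤ Nat.card {z : Fin t // g (Sum.inr z) = Sum.inr z} + m := by
    have h4 := Set.ncard_add_ncard_compl {z : Fin t | g (Sum.inr z) = Sum.inr z}
    have h5 : {z : Fin t | g (Sum.inr z) = Sum.inr z}ᶜ.ncard ≤ {v | g v ≠ v}.ncard := by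
      rw [← Set.ncard_image_of_injective _ (Sum.inr_injective (α := A))]
      refine Set.ncard_le_ncard ?_
      rintro _ ⟨z, hz, rfl⟩
      exact hz
    rw [Nat.card_eq_fintype_card (α := Fin t), Fintype.card_fin] at h4
    have h6 : Nat.card {z : Fin t // g (Sum.inr z) = Sum.inr z} =
      {z : Fin t | g (Sum.inr z) = Sum.inr z}.ncard := Nat.card_coe_set_eq _
    omega
  rw [h1, ncard_le_aut, invCount_eq, ← pow_add, ← pow_add]
  exact Nat.pow_le_pow_right two_pos (by omega)

theorem aut_eq_map_of_fixes {D : Set (RelTuple r (A ⊕ B))}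
    (h : ∀ g ∈ aut D, ∀ b : B, g (Sum.inr b) = Sum.inr b) :
    aut D = (restrAut D).map (extendHom A B) := by
  refine le_antisymm (fun g hg => ?_) (le_restrAut_iff.1 le_rfl)
  have hinl : ∀ (f : Perm (A ⊕ B)), f ∈ aut D → ∀ a, ∃ a', f (Sum.inl a) = Sum.inl a' := by
    intro f hf a
    rcases hfa : f (Sum.inl a) with a' | b
    · exact ⟨a', rfl⟩
    · have := h f hf b
      exact absurd (f.injective (this.trans hfa.symm)) (by simp)
  choose u hu using hinl g hg
  choose w hw using hinl g⁻¹ (inv_mem hg)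
  have huw : ∀ a, u (w a) = a := fun a => Sum.inl_injective (β := B) (by
    rw [← hu, ← hw]
    exact g.apply_symm_apply _)
  have hwu : ∀ a, w (u a) = a := fun a => Sum.inl_injective (β := B) (by
    rw [← hw, ← hu]
    exact g.symm_apply_apply _)
  have hg' : extendHom A B ⟨u, w, hwu, huw⟩ = g := by
    ext1 v
    rcases v with a | b
    · exact (hu a).symm
    · exact (h g hg b).symm
  refine ⟨⟨u, w, hwu, huw⟩, ?_, hg'⟩
  change extendHom A B _ ∈ aut D
  rwa [hg']

theorem restrAut_eq_of_aut_eq {D : Set (RelTuple r (A ⊕ B))} {K : Subgroup (Perm A)}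
    (h : aut D = K.map (extendHom A B)) : restrAut D = K := by
  rw [restrAut, h, Subgroup.comap_map_eq_self_of_injective extendHom_injective]

theorem restrCount_le_add [Finite ι] [Finite A] (K : Subgroup (Perm A)) {i : ι}
    (hi : 2 ≤ r i) {m t : ℕ} (hmt : m ≤ t) :
    restrCount r K t * 2 ^ t ≤ autCount r K t * 2 ^ t +
      {D : Set (RelTuple r (A ⊕ Fin t)) | m < (moved (aut D)).ncard}.ncard * 2 ^ t +
      (Nat.card A + t) ^ (2 * m) * (invCount r K t * 2 ^ m) := by
  classical
  have := Fintype.ofFinite A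
  set n := Nat.card A + t with hn
  have hV : Nat.card (A ⊕ Fin t) = n := by simp [hn]
  let P : Finset (Finset (A ⊕ Fin t)) := Finset.powersetCard m Finset.univ
  let S : Finset (A ⊕ Fin t) → Set (Perm (A ⊕ Fin t)) := fun Y => {g | ∀ v, v ∉ Y → g v = v}
  let J : Finset (Perm (A ⊕ Fin t)) := Finset.univ.filter fun g =>
    {v | g v ≠ v}.ncard ≤ m ∧ ∃ b : Fin t, g (Sum.inr b) ≠ Sum.inr b
  have hJ : J.card ≤ n ^ (2 * m) := by
    have h1 : (J : Set (Perm (A ⊕ Fin t))).ncard ≤ ∑ Y ∈ P, (S Y).ncard := by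
      refine Set.ncard_le_sum_of_forall_exists _ _ _ fun g hg => ?_
      obtain ⟨hg, -⟩ := (Finset.mem_filter.1 (Finset.mem_coe.1 hg)).2
      rw [Set.ncard_eq_toFinset_card'] at hg
      obtain ⟨Y, hY, hYc⟩ := Finset.exists_superset_card_eq hg (by
        rw [← Nat.card_eq_fintype_card, hV]
        omega)
      refine ⟨Y, Finset.mem_powersetCard.2 ⟨Finset.subset_univ _, hYc⟩, fun v hv => ?_⟩
      by_contra hne
      exact hv (hY (by simpa using hne))
    rw [Set.ncard_coe_finset] at h1
    refine h1.trans ?_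
    calc ∑ Y ∈ P, (S Y).ncard ≤ ∑ Y ∈ P, n ^ m := by
          refine Finset.sum_le_sum fun Y hY => ?_
          have h2 := card_perm_fixing_compl_le (Y : Set (A ⊕ Fin t))
          rw [Set.ncard_coe_finset, (Finset.mem_powersetCard.1 hY).2, hV] at h2
          rw [← Nat.card_coe_set_eq]
          exact h2
      _ = n.choose m * n ^ m := by
          rw [Finset.sum_const, Finset.card_powersetCard, Finset.card_univ,
            ← Nat.card_eq_fintype_card, hV, smul_eq_mul]
      _ ≤ n ^ m * n ^ m := by
          gcongr
          exact Nat.choose_le_pow n m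
      _ = n ^ (2 * m) := by ring
  have h1 : {D : Set (RelTuple r (A ⊕ Fin t)) | restrAut D = K} ⊆
      ({D | aut D = K.map (extendHom A (Fin t))} ∪ {D | m < (moved (aut D)).ncard}) ∪
      {D | ∃ g ∈ J, K ≤ restrAut D ∧ g ∈ aut D} := by
    intro D hD
    have hD' : restrAut D = K := hD
    by_cases hm : m < (moved (aut D)).ncard
    · exact Or.inl (Or.inr hm)
    by_cases hfix : ∀ g ∈ aut D, ∀ b : Fin t, g (Sum.inr b) = Sum.inr b
    · left; left
      change aut D = _
      rw [aut_eq_map_of_fixes hfix, hD']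
    · right
      push Not at hfix
      obtain ⟨g, hg, b, hb⟩ := hfix
      refine ⟨g, ?_, hD'.ge, hg⟩
      simp only [J, Finset.mem_filter, Finset.mem_univ, true_and]
      refine ⟨(Set.ncard_le_ncard ?_).trans (not_lt.1 hm), b, hb⟩
      exact fun v hv => ⟨g, hg, hv⟩
  have h2 : {D : Set (RelTuple r (A ⊕ Fin t)) | ∃ g ∈ J, K ≤ restrAut D ∧ g ∈ aut D}.ncard * 2 ^ t
      ≤ n ^ (2 * m) * (invCount r K t * 2 ^ m) := by
    calc _ ≤ (∑ g ∈ J, {D : Set (RelTuple r (A ⊕ Fin t)) |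
            K ≤ restrAut D ∧ g ∈ aut D}.ncard) * 2 ^ t := by
          gcongr
          exact Set.ncard_le_sum_of_forall_exists _ _ _ fun D hD => hD
      _ ≤ ∑ g ∈ J, invCount r K t * 2 ^ m := by
          rw [Finset.sum_mul]
          refine Finset.sum_le_sum fun g hg => ?_
          obtain ⟨hg, b, hb⟩ := (Finset.mem_filter.1 hg).2
          exact ncard_invariant_moving_le K hi g b hb hg
      _ ≤ _ := by
          rw [Finset.sum_const, smul_eq_mul]
          gcongr
  have h3 := (Set.ncard_le_ncard h1).trans ((Set.ncard_union_le _ _).trans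
    (Nat.add_le_add_right (Set.ncard_union_le _ _) _))
  calc restrCount r K t * 2 ^ t ≤ _ := Nat.mul_le_mul_right _ h3
    _ ≤ _ := by
      rw [add_mul, add_mul]
      exact Nat.add_le_add_left h2 _

theorem autCount_le_restrCount [Finite ι] [Finite A] (K : Subgroup (Perm A)) (t : ℕ) :
    autCount r K t ≤ restrCount r K t :=
  Set.ncard_le_ncard fun _ hD => restrAut_eq_of_aut_eq hD

theorem exists_ncard_lt_moved_aut_mul_le_invCount [Finite ι] {A : Type} [Finite A] {i : ι}
    (hi : 2 ≤ r i) (hmax : ∀ j, r j ≤ r i) (K : Subgroup (Perm A)) :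
    ∃ m : ℕ, ∀ᶠ t : ℕ in atTop, ∀ (V : Type) [Finite V], Nat.card V = Nat.card A + t →
      {D : Set (RelTuple r V) | m < (moved (aut D)).ncard}.ncard * 2 ^ t ≤ invCount r K t := by
  obtain ⟨C, hC⟩ := exists_two_pow_card_le hmax K
  obtain ⟨m, hm⟩ := exists_ncard_lt_moved_aut_mul_le (r := r) hi C
  refine ⟨m, ?_⟩
  have htend : Tendsto (fun t => Nat.card A + t) atTop atTop :=
    tendsto_atTop_mono (fun t => Nat.le_add_left t _) tendsto_id
  filter_upwards [htend.eventually hm, eventually_ge_atTop 1] with t ht ht1 V _ hV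
  have h1 := ht V hV
  have := Fintype.ofFinite ι
  have hcard : Nat.card (RelTuple r V) = Nat.card (RelTuple r (A ⊕ Fin t)) := by
    rw [natCard_eq, natCard_eq, hV]
    simp
  rw [hcard] at h1
  have h2 := h1.trans (hC t ht1)
  rw [pow_add, mul_comm (2 ^ _) (2 ^ _), ← mul_assoc] at h2
  refine le_trans ?_ (Nat.le_of_mul_le_mul_right h2 (by positivity))
  gcongr
  · norm_num
  · omega

/-- Almost all structures whose automorphisms on `A` are given by `K` have no automorphisms
moving points outside `A`. -/
theorem tendsto_autCount_div [Finite ι] {A : Type} [Finite A] {i : ι}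
    (hi : 2 ≤ r i) (hmax : ∀ j, r j ≤ r i) {K : Subgroup (Perm A)} {c : ℝ}
    (h : Tendsto (fun t => (restrCount r K t : ℝ) / invCount r K t) atTop (𝓝 c)) :
    Tendsto (fun t => (autCount r K t : ℝ) / invCount r K t) atTop (𝓝 c) := by
  obtain ⟨m, hm⟩ := exists_ncard_lt_moved_aut_mul_le_invCount hi hmax K
  have h0 : Tendsto (fun t : ℕ => (1 / 2 : ℝ) ^ t + 2 ^ (3 * m) *
      ((t : ℝ) ^ (2 * m) * (1 / 2) ^ t)) atTop (𝓝 (0 + 2 ^ (3 * m) * 0)) :=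
    (tendsto_pow_atTop_nhds_zero_of_lt_one (by norm_num) (by norm_num)).add
      ((tendsto_pow_const_mul_const_pow_of_abs_lt_one _
        (by rw [abs_of_pos] <;> norm_num)).const_mul _)
  have h1 : Tendsto (fun t => (restrCount r K t : ℝ) / invCount r K t -
      (autCount r K t : ℝ) / invCount r K t) atTop (𝓝 0) := by
    rw [mul_zero, add_zero] at h0
    refine squeeze_zero' (Eventually.of_forall fun t => ?_) ?_ h0
    · rw [← sub_div]
      refine div_nonneg (sub_nonneg.2 ?_) (Nat.cast_nonneg _)
      exact_mod_cast autCount_le_restrCount K t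
    · filter_upwards [hm, eventually_ge_atTop m, eventually_ge_atTop (Nat.card A)] with
        t ht htm htA
      have h2 := ht (A ⊕ Fin t) (by simp)
      have h3 := restrCount_le_add K hi htm
      have h4 : (Nat.card A + t) ^ (2 * m) ≤ (2 * t) ^ (2 * m) :=
        Nat.pow_le_pow_left (by omega) _
      have h5 : (restrCount r K t : ℝ) * 2 ^ t ≤ autCount r K t * 2 ^ t +
          invCount r K t + (2 * t) ^ (2 * m) * (invCount r K t * 2 ^ m) := by
        exact_mod_cast h3.trans (Nat.add_le_add (Nat.add_le_add_left h2 _)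
          (Nat.mul_le_mul_right _ h4))
      have hpos := invCount_pos (r := r) K t
      rw [← sub_div, div_le_iff₀ hpos]
      refine le_of_mul_le_mul_right ?_ (show (0 : ℝ) < 2 ^ t by positivity)
      have h6 : (1 / 2 : ℝ) ^ t * 2 ^ t = 1 := by rw [← mul_pow]; norm_num
      calc ((restrCount r K t : ℝ) - autCount r K t) * 2 ^ t
          ≤ invCount r K t + (2 * t) ^ (2 * m) * (invCount r K t * 2 ^ m) := by linarith
        _ = (1 + 2 ^ (3 * m) * (t : ℝ) ^ (2 * m)) * invCount r K t *
            ((1 / 2 : ℝ) ^ t * 2 ^ t) := by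
          rw [h6, mul_pow, show 3 * m = 2 * m + m by ring, pow_add]
          ring
        _ = _ := by ring
  have h2 := h.sub h1
  simpa using h2

theorem hasGrowth_autCount [Finite ι] {A : Type} [Finite A] {i : ι}
    (hi : 2 ≤ r i) (hmax : ∀ j, r j ≤ r i) (K : Subgroup (Perm A)) :
    HasGrowth (fun t => (autCount r K t : ℝ)) ∨ ∀ t, autCount r K t = 0 := by
  by_cases h : ∃ t, restrCount r K t ≠ 0
  · obtain ⟨t₀, ht₀⟩ := h
    obtain ⟨c, hc, hlim⟩ := exists_pos_tendsto_restrCount_div ht₀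
    exact Or.inl ((hasGrowth_invCount K).of_tendsto_div hc (tendsto_autCount_div hi hmax hlim))
  · push Not at h
    exact Or.inr fun t => Nat.eq_zero_of_le_zero (h t ▸ autCount_le_restrCount K t)

/-! ### Sorting structures by their automorphism groups -/

theorem moved_map_permCongr {V W : Type*} (e : V ≃ W) (F : Subgroup (Perm V)) :
    moved (F.map e.permCongrHom.toMonoidHom) = e '' moved F := by
  ext w
  constructor
  · rintro ⟨_, ⟨g, hg, rfl⟩, hw⟩
    refine ⟨e.symm w, ⟨g, hg, fun h => hw ?_⟩, e.apply_symm_apply w⟩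
    change e (g (e.symm w)) = w
    rw [h, e.apply_symm_apply]
  · rintro ⟨v, ⟨g, hg, hv⟩, rfl⟩
    refine ⟨_, ⟨g, hg, rfl⟩, fun h => hv ?_⟩
    have h' : e (g (e.symm (e v))) = e v := h
    simpa using h'

theorem moved_map_extendHom {A B : Type*} {K : Subgroup (Perm A)} (hK : moved K = Set.univ) :
    moved (K.map (extendHom A B)) = Set.range Sum.inl := by
  ext v
  constructor
  · rintro ⟨_, ⟨g, -, rfl⟩, hv⟩
    rcases v with a | b
    · exact ⟨a, rfl⟩
    · exact absurd rfl hv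
  · rintro ⟨a, rfl⟩
    obtain ⟨g, hg, hga⟩ := hK.ge (Set.mem_univ a)
    exact ⟨_, ⟨g, hg, rfl⟩, fun h => hga (Sum.inl_injective h)⟩

variable (P : ∀ (Γ : Type) [Group Γ], Prop)

variable (r) in
/-- The number of structures on `Fin n` whose automorphism group has the property `P`. -/
noncomputable def propCount (n : ℕ) : ℕ := {D : Set (RelTuple r (Fin n)) | P (aut D)}.ncard

variable {P}

theorem iff_of_mulEquiv (hP : ∀ (Γ Δ : Type) [Group Γ] [Group Δ], Γ ≃* Δ → P Γ → P Δ)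
    {Γ Δ : Type} [Group Γ] [Group Δ] (e : Γ ≃* Δ) : P Γ ↔ P Δ :=
  ⟨hP _ _ e, hP _ _ e.symm⟩

theorem prop_map_iff (hP : ∀ (Γ Δ : Type) [Group Γ] [Group Δ], Γ ≃* Δ → P Γ → P Δ)
    {Γ Δ : Type} [Group Γ] [Group Δ] {f : Γ →* Δ} (hf : Function.Injective f)
    (F : Subgroup Γ) : P (F.map f) ↔ P F :=
  (iff_of_mulEquiv hP (F.equivMapOfInjective f hf)).symm

theorem ncard_moved_aut_eq_range_inl [Finite ι]
    (hP : ∀ (Γ Δ : Type) [Group Γ] [Group Δ], Γ ≃* Δ → P Γ → P Δ)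
    {A : Type} [Finite A] [Fintype (Subgroup (Perm A))]
    [DecidablePred fun K : Subgroup (Perm A) => moved K = Set.univ ∧ P K] (t : ℕ) :
    {D : Set (RelTuple r (A ⊕ Fin t)) | P (aut D) ∧ moved (aut D) = Set.range Sum.inl}.ncard =
      ∑ K : Subgroup (Perm A) with moved K = Set.univ ∧ P K, autCount r K t := by
  have key : ∀ D : Set (RelTuple r (A ⊕ Fin t)),
      P (aut D) ∧ moved (aut D) = Set.range Sum.inl →
        aut D = (restrAut D).map (extendHom A (Fin t)) ∧
          moved (restrAut D) = Set.univ ∧ P (restrAut D) := by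
    rintro D ⟨hPD, hD⟩
    have h1 : aut D = (restrAut D).map (extendHom A (Fin t)) := by
      refine aut_eq_map_of_fixes fun g hg b => ?_
      by_contra hne
      obtain ⟨a, ha⟩ := hD.le (show Sum.inr b ∈ moved (aut D) from ⟨g, hg, hne⟩)
      exact absurd ha (by simp)
    refine ⟨h1, Set.eq_univ_of_forall fun a => ?_, ?_⟩
    · obtain ⟨g, hg, hga⟩ := hD.ge ⟨a, rfl⟩
      rw [h1] at hg
      obtain ⟨g', hg', rfl⟩ := hg
      exact ⟨g', hg', fun h => hga (congrArg Sum.inl h)⟩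
    · rwa [h1, prop_map_iff hP extendHom_injective] at hPD
  rw [Set.ncard_eq_sum_ncard_fiber _ restrAut
    (Finset.univ.filter fun K : Subgroup (Perm A) => moved K = Set.univ ∧ P K)
    (fun D hD => by simpa using (key D hD).2)]
  refine Finset.sum_congr rfl fun K hK => ?_
  obtain ⟨hK1, hK2⟩ := (Finset.mem_filter.1 hK).2
  rw [autCount]
  congr 1
  ext D
  constructor
  · rintro ⟨hD, rfl⟩
    exact (key D hD).1
  · intro hD
    have hD' : aut D = K.map (extendHom A (Fin t)) := hD
    refine ⟨⟨?_, ?_⟩, restrAut_eq_of_aut_eq hD'⟩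
    · rw [hD', prop_map_iff hP extendHom_injective]
      exact hK2
    · rw [hD', moved_map_extendHom hK1]

theorem ncard_moved_aut_ncard_eq [Finite ι]
    (hP : ∀ (Γ Δ : Type) [Group Γ] [Group Δ], Γ ≃* Δ → P Γ → P Δ) (n s : ℕ) :
    {D : Set (RelTuple r (Fin n)) | P (aut D) ∧ (moved (aut D)).ncard = s}.ncard =
      n.choose s * {D : Set (RelTuple r (Fin s ⊕ Fin (n - s))) |
        P (aut D) ∧ moved (aut D) = Set.range Sum.inl}.ncard := by
  classical
  rw [Set.ncard_eq_sum_ncard_fiber _ (fun D => (moved (aut D)).toFinset)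
    (Finset.powersetCard s Finset.univ) (fun D hD => by
      rw [Finset.mem_powersetCard, ← Set.ncard_eq_toFinset_card']
      exact ⟨Finset.subset_univ _, hD.2⟩)]
  have hchoose : n.choose s = (Finset.powersetCard s (Finset.univ : Finset (Fin n))).card := by
    rw [Finset.card_powersetCard, Finset.card_univ, Fintype.card_fin]
  rw [hchoose, ← smul_eq_mul, ← Finset.sum_const]
  refine Finset.sum_congr rfl fun Y hY => ?_
  have hYs : (Y : Set (Fin n)).ncard = s := by
    rw [Set.ncard_coe_finset, (Finset.mem_powersetCard.1 hY).2]
  have hYc : (Y : Set (Fin n))ᶜ.ncard = n - s := by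
    have := Set.ncard_add_ncard_compl (Y : Set (Fin n))
    rw [Nat.card_eq_fintype_card, Fintype.card_fin] at this
    omega
  let e₁ : Fin s ≃ (Y : Set (Fin n)) :=
    (Finite.equivFinOfCardEq (by rw [Nat.card_coe_set_eq, hYs])).symm
  let e₂ : Fin (n - s) ≃ ((Y : Set (Fin n))ᶜ : Set (Fin n)) :=
    (Finite.equivFinOfCardEq (by rw [Nat.card_coe_set_eq, hYc])).symm
  let e : Fin s ⊕ Fin (n - s) ≃ Fin n :=
    (Equiv.sumCongr e₁ e₂).trans (Equiv.Set.sumCompl (Y : Set (Fin n)))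
  have he : e '' Set.range Sum.inl = Y := by
    ext v
    constructor
    · rintro ⟨_, ⟨a, rfl⟩, rfl⟩
      exact (e₁ a).2
    · intro hv
      refine ⟨_, ⟨e₁.symm ⟨v, hv⟩, rfl⟩, ?_⟩
      simp only [e, Equiv.trans_apply, Equiv.sumCongr_apply, Sum.map_inl, Equiv.apply_symm_apply]
      exact Equiv.Set.sumCompl_apply_inl (Y : Set (Fin n)) ⟨v, hv⟩
  have h1 : {D : Set (RelTuple r (Fin n)) |
      D ∈ {D : Set (RelTuple r (Fin n)) | P (aut D) ∧ (moved (aut D)).ncard = s} ∧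
        (moved (aut D)).toFinset = Y} = {D | P (aut D) ∧ moved (aut D) = Y} := by
    ext D
    constructor
    · rintro ⟨⟨h1, -⟩, h2⟩
      exact ⟨h1, by rw [← h2, Set.coe_toFinset]⟩
    · rintro ⟨h1, h2⟩
      exact ⟨⟨h1, by rw [h2, hYs]⟩, by simp [h2]⟩
  rw [h1, ncard_aut_congr e fun F => P F ∧ moved F = Y]
  congr 1
  ext D
  have hinj : Function.Injective e.permCongrHom.toMonoidHom := e.permCongrHom.injective
  change P _ ∧ _ ↔ P _ ∧ _
  rw [prop_map_iff hP hinj, moved_map_permCongr, ← he, e.injective.image_injective.eq_iff]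

open Classical in
theorem propCount_eq_sum_add [Finite ι]
    (hP : ∀ (Γ Δ : Type) [Group Γ] [Group Δ], Γ ≃* Δ → P Γ → P Δ)
    [∀ s, Fintype (Subgroup (Perm (Fin s)))] (m n : ℕ) :
    propCount r P n = ∑ s ∈ Finset.range (m + 1), n.choose s *
        ∑ K : Subgroup (Perm (Fin s)) with moved K = Set.univ ∧ P K, autCount r K (n - s) +
      {D : Set (RelTuple r (Fin n)) | P (aut D) ∧ m < (moved (aut D)).ncard}.ncard := by
  rw [propCount, Set.ncard_eq_sum_ncard_fiber _
    (fun D => min (moved (aut D)).ncard (m + 1)) (Finset.range (m + 2))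
    (fun D _ => by simp), Finset.sum_range_succ]
  congr 1
  · refine Finset.sum_congr rfl fun s hs => ?_
    rw [← ncard_moved_aut_eq_range_inl hP, ← ncard_moved_aut_ncard_eq hP]
    congr 1
    ext D
    have := Finset.mem_range.1 hs
    refine and_congr_right fun _ => ?_
    omega
  · congr 1
    ext D
    refine and_congr_right fun _ => ?_
    omega

theorem autCount_le_propCount [Finite ι]
    (hP : ∀ (Γ Δ : Type) [Group Γ] [Group Δ], Γ ≃* Δ → P Γ → P Δ)
    {A : Type} [Finite A] {K : Subgroup (Perm A)} (hK : P K) {n : ℕ} (hn : Nat.card A ≤ n) :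
    autCount r K (n - Nat.card A) ≤ propCount r P n := by
  let e : Fin n ≃ A ⊕ Fin (n - Nat.card A) := (Finite.equivFinOfCardEq (by simp; omega)).symm
  have h := ncard_aut_congr (r := r) e fun F => P F
  have hinj : Function.Injective e.permCongrHom.toMonoidHom := e.permCongrHom.injective
  simp only [prop_map_iff hP hinj] at h
  rw [propCount, ← h]
  refine Set.ncard_le_ncard fun D hD => ?_
  have hD' : aut D = K.map (extendHom A _) := hD
  change P (aut D)
  rw [hD', prop_map_iff hP extendHom_injective]
  exact hK

/-- If the automorphisms on `A` of some structure on `A ⊕ Fin t₀` form a group with the property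
`P`, then the number of structures whose automorphism group has the property `P` is
asymptotic to `q * n ^ k * 2 ^ e n` for a polynomial `e`. -/
theorem hasGrowth_propCount [Finite ι] {i : ι} (hi : 2 ≤ r i) (hmax : ∀ j, r j ≤ r i)
    (hP : ∀ (Γ Δ : Type) [Group Γ] [Group Δ], Γ ≃* Δ → P Γ → P Δ)
    {A : Type} [Finite A] {K : Subgroup (Perm A)} (hK : P K) {t₀ : ℕ}
    (ht₀ : restrCount r K t₀ ≠ 0) : HasGrowth fun n => (propCount r P n : ℝ) := by
  classical
  have hfin : ∀ s, Fintype (Subgroup (Perm (Fin s))) := fun s => Fintype.ofFinite _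
  obtain ⟨c, hc, hlim⟩ := exists_pos_tendsto_restrCount_div ht₀
  have hlim' := tendsto_autCount_div hi hmax hlim
  have hgrow : HasGrowth fun n => (autCount r K (n - Nat.card A) : ℝ) :=
    ((hasGrowth_invCount K).of_tendsto_div hc hlim').comp_sub (Nat.card A)
  obtain ⟨m, hm⟩ := exists_ncard_lt_moved_aut_mul_le_invCount hi hmax K
  set main : ℕ → ℝ := fun n => ∑ s ∈ Finset.range (m + 1), (n.choose s : ℝ) *
    ∑ K : Subgroup (Perm (Fin s)) with moved K = Set.univ ∧ P K, (autCount r K (n - s) : ℝ)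
    with hmain
  set err : ℕ → ℝ := fun n =>
    ({D : Set (RelTuple r (Fin n)) | P (aut D) ∧ m < (moved (aut D)).ncard}.ncard : ℝ) with herr
  have hsplit : ∀ n, (propCount r P n : ℝ) = main n + err n := by
    intro n
    rw [propCount_eq_sum_add hP m n]
    push_cast
    rfl
  have hpos : ∀ᶠ n in atTop, (0 : ℝ) < propCount r P n := by
    filter_upwards [hgrow.eventually_pos, eventually_ge_atTop (Nat.card A)] with n h1 h2
    exact h1.trans_le (by exact_mod_cast autCount_le_propCount hP hK h2)
  have herr0 : Tendsto (fun n => err n / propCount r P n) atTop (𝓝 0) := by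
    have h1 : Tendsto (fun t : ℕ => (1 / 2 : ℝ) ^ t * ((autCount r K t : ℝ) / invCount r K t)⁻¹)
        atTop (𝓝 (0 * (c : ℝ)⁻¹)) :=
      (tendsto_pow_atTop_nhds_zero_of_lt_one (by norm_num) (by norm_num)).mul
        (hlim'.inv₀ (by exact_mod_cast hc.ne'))
    rw [zero_mul] at h1
    refine squeeze_zero' (Eventually.of_forall fun n => by positivity) ?_
      (h1.comp (tendsto_sub_atTop_nat (Nat.card A)))
    filter_upwards [(tendsto_sub_atTop_nat (Nat.card A)).eventually hm, hgrow.eventually_pos,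
      eventually_ge_atTop (Nat.card A)] with n h2 h3 h4
    have h5 := h2 (Fin n) (by simp; omega)
    have h6 : err n * 2 ^ (n - Nat.card A) ≤ invCount r K (n - Nat.card A) := by
      have h7 : {D : Set (RelTuple r (Fin n)) | P (aut D) ∧ m < (moved (aut D)).ncard}.ncard ≤
          {D : Set (RelTuple r (Fin n)) | m < (moved (aut D)).ncard}.ncard :=
        Set.ncard_le_ncard fun D hD => hD.2
      simp only [herr]
      exact_mod_cast (Nat.mul_le_mul_right _ h7).trans h5
    have h8 : (autCount r K (n - Nat.card A) : ℝ) ≤ propCount r P n := by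
      exact_mod_cast autCount_le_propCount hP hK h4
    simp only [Function.comp]
    calc err n / propCount r P n ≤ err n / autCount r K (n - Nat.card A) := by gcongr
      _ ≤ ((1 / 2) ^ (n - Nat.card A) * invCount r K (n - Nat.card A)) /
          autCount r K (n - Nat.card A) := by
        gcongr
        rw [one_div, inv_pow, inv_mul_eq_div, le_div_iff₀ (by positivity)]
        exact h6
      _ = _ := by rw [inv_div, mul_div_assoc]
  have hmain1 : Tendsto (fun n => main n / propCount r P n) atTop (𝓝 1) := by
    have h1 := herr0.const_sub 1
    rw [sub_zero] at h1
    refine h1.congr' ?_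
    filter_upwards [hpos] with n hn
    rw [eq_div_iff hn.ne', sub_mul, div_mul_cancel₀ _ hn.ne', hsplit]
    ring
  have hmainGrowth : HasGrowth main ∨ ∀ᶠ n in atTop, main n = 0 := by
    refine HasGrowth.sum _ _ fun s _ => ?_
    have h1 := HasGrowth.sum
      (Finset.univ.filter fun K : Subgroup (Perm (Fin s)) => moved K = Set.univ ∧ P K)
      (fun K t => (autCount r K t : ℝ)) (fun K _ => (hasGrowth_autCount hi hmax K).imp_right
        fun h => Eventually.of_forall fun t => by rw [h t, Nat.cast_zero])
    rcases h1 with h1 | h1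
    · exact Or.inl ((h1.comp_sub s).choose_mul s)
    · right
      filter_upwards [(tendsto_sub_atTop_nat s).eventually h1] with n hn
      rw [hn, mul_zero]
  rcases hmainGrowth with h | h
  · refine h.of_tendsto_div one_pos ?_
    have := hmain1.inv₀ one_ne_zero
    simpa using this
  · refine absurd (tendsto_nhds_unique hmain1 (tendsto_const_nhds.congr' ?_)) one_ne_zero
    filter_upwards [h] with n hn
    rw [hn, zero_div]

end RelTuple

/-! ### A structure with a given automorphism group -/

namespace RelTuple

open Equiv (Perm)

variable {ι : Type*} {r : ι → ℕ}

variable (r) in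
/-- The structure in which every relation of arity at least two holds of a tuple exactly if the
binary relation `Q` holds of its first two entries, and all other relations are empty. -/
def ofBinary {V : Type*} (Q : V → V → Prop) : Set (RelTuple r V) :=
  {t | ∃ h : 2 ≤ r t.1, Q (t.2 ⟨0, two_pos.trans_le h⟩) (t.2 ⟨1, h⟩)}

theorem mem_aut_ofBinary {V : Type*} {Q : V → V → Prop} {i : ι} (hi : 2 ≤ r i) {g : Perm V} :
    g ∈ aut (ofBinary r Q) ↔ ∀ u v, Q (g u) (g v) ↔ Q u v := by
  constructor
  · intro h u v
    have h1 := h ⟨i, fun j => if j.1 = 0 then u else v⟩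
    constructor
    · intro huv
      obtain ⟨_, h2⟩ := h1.1 ⟨hi, by simpa [smul_mk] using huv⟩
      simpa using h2
    · intro huv
      obtain ⟨_, h2⟩ := h1.2 ⟨hi, by simpa using huv⟩
      simpa [smul_mk] using h2
  · rintro h ⟨j, x⟩
    exact exists_congr fun _ => h _ _

/-- Left multiplication on the first factor of `G × G`. -/
def mulLeftFst (G : Type*) [Group G] : G →* Perm (G × G) where
  toFun g := (Equiv.mulLeft g).prodCongr (Equiv.refl G)
  map_one' := by ext p <;> simp
  map_mul' g h := by ext p <;> simp [mul_assoc]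

theorem mulLeftFst_apply {G : Type*} [Group G] (g : G) (p : G × G) :
    mulLeftFst G g p = (g * p.1, p.2) := rfl

theorem mulLeftFst_injective (G : Type*) [Group G] : Function.Injective (mulLeftFst G) := by
  intro g h hgh
  have := congrArg Prod.fst (DFunLike.congr_fun hgh (1, 1))
  simpa [mulLeftFst_apply] using this

/-- A form of the Cayley graph of `G` on `G × G`: there is an edge from `(x, c)` to `(x * c, d)`
for all `x`, `c`, `d`, and additional vertices, one for each `c : G`, single out the sets
`G × {c}`. -/
def cayleyRel {G : Type*} [Group G] {B : Type*} (f : G → B) : (G × G) ⊕ B → (G × G) ⊕ B → Prop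
  | Sum.inl u, Sum.inl v => v.1 = u.1 * u.2
  | Sum.inr b, Sum.inl u => f u.2 = b
  | _, Sum.inr _ => False

theorem restrAut_ofBinary_cayleyRel {G : Type*} [Group G] {B : Type*} {f : G → B}
    (hf : Function.Injective f) {i : ι} (hi : 2 ≤ r i) :
    restrAut (ofBinary r (cayleyRel f)) = (mulLeftFst G).range := by
  ext σ
  rw [restrAut, Subgroup.mem_comap, mem_aut_ofBinary hi]
  constructor
  · intro h
    have h2 : ∀ u, (σ u).2 = u.2 := fun u => hf ((h (Sum.inr (f u.2)) (Sum.inl u)).2 rfl)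
    have h1 : ∀ u v : G × G, v.1 = u.1 * u.2 → (σ v).1 = (σ u).1 * u.2 := fun u v huv => by
      rw [← h2 u]
      exact (h (Sum.inl u) (Sum.inl v)).2 huv
    refine ⟨(σ (1, 1)).1, Equiv.ext fun ⟨c, d⟩ => ?_⟩
    have h3 := h1 (1, 1) (1, c) (by simp)
    have h4 := h1 (1, c) (c, d) (by simp)
    rw [mulLeftFst_apply]
    refine Prod.ext ?_ (h2 (c, d)).symm
    simp [h4, h3]
  · rintro ⟨g, rfl⟩ (u | b) (v | b')
    · simp [cayleyRel, mulLeftFst_apply, mul_assoc]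
    · rfl
    · rfl
    · rfl

/-- For every finite group `G`, the number of structures whose automorphism group has the property
`P` is of the form required for the limits, if `P` holds for all groups isomorphic to `G`. -/
theorem hasGrowth_propCount_of_mulEquiv [Finite ι] {i : ι} (hi : 2 ≤ r i) (hmax : ∀ j, r j ≤ r i)
    {P : ∀ (Γ : Type) [Group Γ], Prop}
    (hP : ∀ (Γ Δ : Type) [Group Γ] [Group Δ], Γ ≃* Δ → P Γ → P Δ) (G : Type*) [Group G] [Finite G]
    (hG : ∀ (Γ : Type) [Group Γ], G ≃* Γ → P Γ) :
    HasGrowth fun n => (propCount r P n : ℝ) := by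
  obtain ⟨G', _, _, ⟨e⟩⟩ := Finite.exists_type_univ_nonempty_mulEquiv.{_, 0} G
  refine hasGrowth_propCount hi hmax hP (K := (mulLeftFst G').range)
    (hG _ (e.trans (MonoidHom.ofInjective (mulLeftFst_injective G')))) (t₀ := Nat.card G') ?_
  have hmem : ofBinary r (cayleyRel (Finite.equivFin G')) ∈
      {D : Set (RelTuple r (G' × G' ⊕ Fin (Nat.card G'))) |
        restrAut D = (mulLeftFst G').range} :=
    restrAut_ofBinary_cayleyRel (Finite.equivFin G').injective hi
  exact Set.ncard_ne_zero_of_mem hmem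

end RelTuple

/-! ### First-order structures over a relational language -/

namespace FirstOrder.Language

variable {L : Language} {M : Type*}

theorem exists_relation_arity_max [Finite (Σ k, L.Relations k)]
    (hL : ∃ k, 2 ≤ k ∧ Nonempty (L.Relations k)) :
    ∃ i : Σ k, L.Relations k, 2 ≤ i.1 ∧ ∀ j : Σ k, L.Relations k, j.1 ≤ i.1 := by
  obtain ⟨k, hk, ⟨R⟩⟩ := hL
  have : Nonempty (Σ k, L.Relations k) := ⟨⟨k, R⟩⟩
  obtain ⟨i, hi⟩ := Finite.exists_max fun R : Σ k, L.Relations k => R.1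
  exact ⟨i, hk.trans (hi ⟨k, R⟩), hi⟩

variable [L.IsRelational]

/-- A structure over a relational language amounts to the set of the tuples that belong to its
relations. -/
def structureEquiv (L : Language) [L.IsRelational] (M : Type*) :
    L.Structure M ≃ Set (RelTuple (fun R : Σ k, L.Relations k => R.1) M) where
  toFun S := {t | S.RelMap t.1.2 t.2}
  invFun D := { funMap := fun f => isEmptyElim f, RelMap := fun R x => ⟨⟨_, R⟩, x⟩ ∈ D }
  left_inv S := by
    ext n f
    · exact isEmptyElim f
    · rfl
  right_inv D := rfl

theorem autGroup_eq (S : L.Structure M) : autGroup S = RelTuple.aut (structureEquiv L M S) := by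
  ext g
  constructor
  · rintro ⟨φ, rfl⟩ ⟨⟨k, R⟩, x⟩
    exact φ.map_rel R x
  · intro h
    exact ⟨{ g with
      map_fun' := fun f => isEmptyElim f
      map_rel' := fun R x => h ⟨⟨_, R⟩, x⟩ }, rfl⟩

theorem ncard_autGroup (P : ∀ (Γ : Type) [Group Γ], Prop) (n : ℕ) :
    {S : L.Structure (Fin n) | P (autGroup S)}.ncard =
      RelTuple.propCount (fun R : Σ k, L.Relations k => R.1) P n := by
  rw [RelTuple.propCount, ← Set.ncard_image_of_injective _ (structureEquiv L (Fin n)).injective]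
  congr 1
  ext D
  obtain ⟨S, rfl⟩ := (structureEquiv L (Fin n)).surjective D
  rw [(structureEquiv L (Fin n)).injective.mem_set_image]
  change P _ ↔ P _
  rw [autGroup_eq]

variable [Finite (Σ k, L.Relations k)]

theorem hasGrowth_countLeAut (hL : ∃ k, 2 ≤ k ∧ Nonempty (L.Relations k))
    (G : Type*) [Group G] [Finite G] : HasGrowth fun n => (L.countLeAut G n : ℝ) := by
  obtain ⟨i, hi, hmax⟩ := exists_relation_arity_max hL
  have h := RelTuple.hasGrowth_propCount_of_mulEquiv
    (r := fun R : Σ k, L.Relations k => R.1) hi hmax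
    (P := fun Γ _ => ∃ K : Subgroup Γ, Nonempty (G ≃* K))
    (fun Γ Δ _ _ e ⟨K, ⟨f⟩⟩ => ⟨K.map e.toMonoidHom,
      ⟨f.trans (K.equivMapOfInjective e.toMonoidHom e.injective)⟩⟩) G
    (fun Γ _ e => ⟨⊤, ⟨e.trans Subgroup.topEquiv.symm⟩⟩)
  simpa only [countLeAut, ncard_autGroup (L := L)
    (fun Γ _ => ∃ K : Subgroup Γ, Nonempty (G ≃* K))] using h

theorem hasGrowth_countIsoAut (hL : ∃ k, 2 ≤ k ∧ Nonempty (L.Relations k))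
    (G : Type*) [Group G] [Finite G] : HasGrowth fun n => (L.countIsoAut G n : ℝ) := by
  obtain ⟨i, hi, hmax⟩ := exists_relation_arity_max hL
  have h := RelTuple.hasGrowth_propCount_of_mulEquiv
    (r := fun R : Σ k, L.Relations k => R.1) hi hmax (P := fun Γ _ => Nonempty (G ≃* Γ))
    (fun Γ Δ _ _ e ⟨f⟩ => ⟨f.trans e⟩) G (fun Γ _ e => ⟨e⟩)
  simpa only [countIsoAut, ncard_autGroup (L := L) (fun Γ _ => Nonempty (G ≃* Γ))] using h

end FirstOrder.Language

theorem mainTheorem1 (L : FirstOrder.Language) [L.IsRelational]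
    [Finite (Σ k, L.Relations k)] (hL : ∃ k, 2 ≤ k ∧ Nonempty (L.Relations k))
    (G H : Type*) [Group G] [Finite G] [Group H] [Finite H] :
    HasLimitInRatOrInfty (L.countLeAut H) (L.countLeAut G) ∧
    HasLimitInRatOrInfty (L.countIsoAut H) (L.countIsoAut G) ∧
    HasLimitInRatOrInfty (L.countIsoAut G) (L.countLeAut G) :=
  ⟨(FirstOrder.Language.hasGrowth_countLeAut hL H).hasLimitInRatOrInfty
      (FirstOrder.Language.hasGrowth_countLeAut hL G),
    (FirstOrder.Language.hasGrowth_countIsoAut hL H).hasLimitInRatOrInfty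
      (FirstOrder.Language.hasGrowth_countIsoAut hL G),
    (FirstOrder.Language.hasGrowth_countIsoAut hL G).hasLimitInRatOrInfty
      (FirstOrder.Language.hasGrowth_countLeAut hL G)⟩
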